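/- Let $d\ge 0$ be an integer and let $\mathbb{Q}(v)$ be the field of rational functions in an indeterminate $v$. Let $\mathbf U=\mathbf U_v(\mathfrak{gl}_2)$ be the associative unital $\mathbb{Q}(v)$-algebra with generators $e,f,K_1,K_1^{-1},K_2,K_2^{-1}$ and relations $$K_1K_2=K_2K_1,\qquad K_iK_i^{-1}=K_i^{-1}K_i=1\ (i=1,2),$$ $$K_1eK_1^{-1}=ve,\quad K_1fK_1^{-1}=v^{-1}f,\quad K_2eK_2^{-1}=v^{-1}e,\quad K_2fK_2^{-1}=vf,$$ $$ef-fe=\frac{K_1K_2^{-1}-K_1^{-1}K_2}{v-v^{-1}}.$$ It is a bialgebra with comultiplication $\Delta(e)=e\otimes 1+K_1K_2^{-1}\otimes e$, $\Delta(f)=f\otimes K_1^{-1}K_2+1\otimes f$, $\Delta(K_i^{\pm1})=K_i^{\pm1}\otimes K_i^{\pm1}$ and counit $e,f\mapsto 0$, $K_i^{\pm 1}\mapsto 1$. Let $E$ be the $\mathbf U$-module with basis $e_1,e_2$ on which $$e\mapsto\begin{pmatrix}0&1\\0&0\end{pmatrix},\quad f\mapsto\begin{pmatrix}0&0\\1&0\end{pmatrix},\quad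 K_1\mapsto\begin{pmatrix}v&0\\0&1\end{pmatrix},\quad K_2\mapsto\begin{pmatrix}1&0\\0&v\end{pmatrix},$$ let $\rho_d:\mathbf U\to\operatorname{End}_{\mathbb{Q}(v)}(E^{\otimes d})$ be the representation on the $d$-th tensor power obtained by iterating $\Delta$ (for $d=0$ it is given by the counit), and let the quantum Schur algebra $S_v(2,d)$ be the image of $\rho_d$. Let $\mathcal B_d$ be the $\mathbb{Q}(v)$-algebra with the same generators as $\mathbf U$, subject to the relations of $\mathbf U$ and the additional relations $$K_1K_2=v^d,\qquad (K_1-1)(K_1-v)\cdots(K_1-v^d)=0.$$ For $m,t\in\mathbb{N}$ (with $0\in\mathbb{N}$) put $[r]=\frac{v^r-v^{-r}}{v-v^{-1}}$, $[m]!=[m][m-1]\cdots[1]$, $X^{(m)}=X^m/[m]!$, and, for invertible $X$, $\begin{bmatrix}X\\t\end{bmatrix}=\prod_{s=1}^{t}\frac{Xv^{-s+1}-X^{-1}v^{s-1}}{v^s-v^{-s}}$. **Theorem.** There is an isomorphism of $\mathbb{Q}(v)$-algebras $\mathcal B_d\to S_v(2,d)$ which sends each of the generators $e,f,K_1^{\pm1},K_2^{\pm1}$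 to its image under $\rho_d$. Moreover, the monomials $$e^{(a)}\begin{bmatrix}K_1\\b_1\end{bmatrix}\begin{bmatrix}K_2\\b_2\end{bmatrix}f^{(c)}\qquad(a,b_1,b_2,c\in\mathbb{N},\ b_1+b_2=d,\ a+b_1+c\le d)$$ are pairwise distinct and form a $\mathbb{Q}(v)$-basis of $\mathcal B_d$ (respectively, formed with the images of the generators, of $S_v(2,d)$), and so do the monomials $$f^{(a)}\begin{bmatrix}K_1\\b_1\end{bmatrix}\begin{bmatrix}K_2\\b_2\end{bmatrix}e^{(c)}\qquad(a,b_1,b_2,c\in\mathbb{N},\ b_1+b_2=d,\ a+b_2+c\le d).$$ -/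

import Mathlib

open scoped TensorProduct

noncomputable section

namespace QSchur

/-- The ground field `ℚ(v)`. -/
abbrev Qv : Type := RatFunc ℚ

/-- The indeterminate `v` of `ℚ(v)`. -/
def v : Qv := RatFunc.X

/-! ### The quantized enveloping algebra of `gl₂` -/

/-- The generators `e, f, K₁, K₁⁻¹, K₂, K₂⁻¹`. -/
inductive Gen : Type
  | e | f | K1 | K1inv | K2 | K2inv

/-- The free `ℚ(v)`-algebra on the six generators. -/
abbrev Free : Type := FreeAlgebra Qv Gen

/-- A generator, as an element of the free algebra. -/
abbrev g (x : Gen) : Free := FreeAlgebra.ι Qv x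

open Gen in
/-- The defining relations of `U = U_v(gl₂)`. -/
inductive URel : Free → Free → Prop
  | comm : URel (g K1 * g K2) (g K2 * g K1)
  | K1_mul_inv : URel (g K1 * g K1inv) 1
  | K1_inv_mul : URel (g K1inv * g K1) 1
  | K2_mul_inv : URel (g K2 * g K2inv) 1
  | K2_inv_mul : URel (g K2inv * g K2) 1
  | K1_e : URel (g K1 * g e * g K1inv) (v • g e)
  | K1_f : URel (g K1 * g f * g K1inv) (v⁻¹ • g f)
  | K2_e : URel (g K2 * g e * g K2inv) (v⁻¹ • g e)
  | K2_f : URel (g K2 * g f * g K2inv) (v • g f)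
  | e_f : URel (g e * g f - g f * g e)
      ((v - v⁻¹)⁻¹ • (g K1 * g K2inv - g K1inv * g K2))

/-- The quantized enveloping algebra `U_v(gl₂)` over `ℚ(v)`. -/
abbrev U : Type := RingQuot URel

/-- The image of a generator in `U`. -/
def U.gen (x : Gen) : U := RingQuot.mkAlgHom Qv URel (g x)

/-- The algebra map `U → A` with prescribed values on the generators, when these values satisfy
the defining relations. -/
def U.lift {A : Type} [Ring A] [Algebra Qv A] (F : Gen → A)
    (h : ∀ ⦃x y : Free⦄, URel x y → FreeAlgebra.lift Qv F x = FreeAlgebra.lift Qv F y) :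
    U →ₐ[Qv] A :=
  RingQuot.liftAlgHom Qv ⟨FreeAlgebra.lift Qv F, h⟩

lemma U.rel {x y : Free} (h : URel x y) :
    FreeAlgebra.lift Qv U.gen x = FreeAlgebra.lift Qv U.gen y := by
  have : FreeAlgebra.lift Qv U.gen = RingQuot.mkAlgHom Qv URel := by
    ext x; simp [U.gen]
  rw [this]; exact RingQuot.mkAlgHom_rel Qv h

/-! ### The algebra `B_d` -/

open Gen in
/-- The defining relations of `B_d`: those of `U`, together with `K₁K₂ = v^d` and
`(K₁ - 1)(K₁ - v) ⋯ (K₁ - v^d) = 0`. -/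
inductive BRel (d : ℕ) : Free → Free → Prop
  | ofU {x y : Free} : URel x y → BRel d x y
  | det : BRel d (g K1 * g K2) (algebraMap Qv Free (v ^ d))
  | minpoly : BRel d
      ((List.range (d + 1)).map fun i => g K1 - algebraMap Qv Free (v ^ i)).prod 0

/-- The algebra `B_d` over `ℚ(v)`. -/
abbrev B (d : ℕ) : Type := RingQuot (BRel d)

/-- The image of a generator in `B_d`. -/
def B.gen (d : ℕ) (x : Gen) : B d := RingQuot.mkAlgHom Qv (BRel d) (g x)

/-! ### Comultiplication, counit and the representations -/

/-- Values of the comultiplication on generators (with `K = K₁K₂⁻¹`):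
`e ↦ e ⊗ 1 + K ⊗ e`, `f ↦ f ⊗ K⁻¹ + 1 ⊗ f`, and the `K_i^{±1}` are group-like. -/
def comulGen : Gen → U ⊗[Qv] U
  | .e => U.gen .e ⊗ₜ 1 + (U.gen .K1 * U.gen .K2inv) ⊗ₜ U.gen .e
  | .f => U.gen .f ⊗ₜ (U.gen .K1inv * U.gen .K2) + 1 ⊗ₜ U.gen .f
  | .K1 => U.gen .K1 ⊗ₜ U.gen .K1
  | .K1inv => U.gen .K1inv ⊗ₜ U.gen .K1inv
  | .K2 => U.gen .K2 ⊗ₜ U.gen .K2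
  | .K2inv => U.gen .K2inv ⊗ₜ U.gen .K2inv

lemma v_ne : v ≠ 0 := RatFunc.X_ne_zero

section rels
open Gen

lemma U.K1K1i : U.gen K1 * U.gen K1inv = 1 := by simpa using U.rel URel.K1_mul_inv
lemma U.K1iK1 : U.gen K1inv * U.gen K1 = 1 := by simpa using U.rel URel.K1_inv_mul
lemma U.K2K2i : U.gen K2 * U.gen K2inv = 1 := by simpa using U.rel URel.K2_mul_inv
lemma U.K2iK2 : U.gen K2inv * U.gen K2 = 1 := by simpa using U.rel URel.K2_inv_mul

lemma conj_aux {A : Type} [Ring A] [Algebra Qv A] {k k' x : A} {c : Qv}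
    (hk : k' * k = 1) (h : k * x * k' = c • x) : k * x = c • (x * k) := by
  calc k * x = k * x * k' * k := by rw [mul_assoc _ k', hk, mul_one]
    _ = _ := by rw [h, smul_mul_assoc]

lemma conj_aux_inv {A : Type} [Ring A] [Algebra Qv A] {k k' x : A} {c : Qv} (hc : c ≠ 0)
    (hk : k' * k = 1) (hk2 : k * k' = 1) (h : k * x * k' = c • x) :
    k' * x = c⁻¹ • (x * k') := by
  have h1 := conj_aux hk h
  calc k' * x = k' * (c⁻¹ • (c • (x * k))) * k' := by
        rw [smul_smul, inv_mul_cancel₀ hc, one_smul, mul_assoc, mul_assoc, hk2, mul_one]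
    _ = c⁻¹ • (x * k') := by
        rw [← h1, mul_smul_comm, ← mul_assoc k', hk, one_mul, smul_mul_assoc]

lemma U.K1e : U.gen K1 * U.gen e = v • (U.gen e * U.gen K1) :=
  conj_aux U.K1iK1 (by simpa using U.rel URel.K1_e)
lemma U.K1f : U.gen K1 * U.gen f = v⁻¹ • (U.gen f * U.gen K1) :=
  conj_aux U.K1iK1 (by simpa using U.rel URel.K1_f)
lemma U.K2e : U.gen K2 * U.gen e = v⁻¹ • (U.gen e * U.gen K2) :=
  conj_aux U.K2iK2 (by simpa using U.rel URel.K2_e)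
lemma U.K2f : U.gen K2 * U.gen f = v • (U.gen f * U.gen K2) :=
  conj_aux U.K2iK2 (by simpa using U.rel URel.K2_f)
lemma U.K1ie : U.gen K1inv * U.gen e = v⁻¹ • (U.gen e * U.gen K1inv) :=
  conj_aux_inv v_ne U.K1iK1 U.K1K1i (by simpa using U.rel URel.K1_e)
lemma U.K1if : U.gen K1inv * U.gen f = v • (U.gen f * U.gen K1inv) := by
  simpa using conj_aux_inv (inv_ne_zero v_ne) U.K1iK1 U.K1K1i
    (by simpa using U.rel URel.K1_f)
lemma U.K2ie : U.gen K2inv * U.gen e = v • (U.gen e * U.gen K2inv) := by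
  simpa using conj_aux_inv (inv_ne_zero v_ne) U.K2iK2 U.K2K2i
    (by simpa using U.rel URel.K2_e)
lemma U.K2if : U.gen K2inv * U.gen f = v⁻¹ • (U.gen f * U.gen K2inv) :=
  conj_aux_inv v_ne U.K2iK2 U.K2K2i (by simpa using U.rel URel.K2_f)
lemma U.K2K1 : U.gen K2 * U.gen K1 = U.gen K1 * U.gen K2 := by
  simpa using (U.rel URel.comm).symm

lemma comm_inv_aux {A : Type} [Ring A] {k k' x : A} (h : k * x = x * k)
    (hk : k' * k = 1) (hk2 : k * k' = 1) : k' * x = x * k' := by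
  calc k' * x = k' * (x * k) * k' := by rw [mul_assoc, mul_assoc, hk2, mul_one]
    _ = x * k' := by rw [← h, ← mul_assoc k', hk, one_mul]

lemma U.K2iK1 : U.gen K2inv * U.gen K1 = U.gen K1 * U.gen K2inv :=
  comm_inv_aux U.K2K1 U.K2iK2 U.K2K2i
lemma U.K2K1i : U.gen K2 * U.gen K1inv = U.gen K1inv * U.gen K2 :=
  (comm_inv_aux U.K2K1.symm U.K1iK1 U.K1K1i).symm
lemma U.K2iK1i : U.gen K2inv * U.gen K1inv = U.gen K1inv * U.gen K2inv :=
  comm_inv_aux U.K2K1i U.K2iK2 U.K2K2i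
lemma U.ef : U.gen e * U.gen f = U.gen f * U.gen e +
    (v - v⁻¹)⁻¹ • (U.gen K1 * U.gen K2inv - U.gen K1inv * U.gen K2) := by
  have := U.rel URel.e_f
  simp only [map_sub, map_mul, map_smul, FreeAlgebra.lift_ι_apply] at this
  rw [← this]; abel

end rels

lemma assoc_aux {A : Type} [Ring A] {a b c : A} (h : a * b = c) (x : A) :
    a * (b * x) = c * x := by rw [← mul_assoc, h]

set_option linter.unusedSimpArgs false in
set_option maxHeartbeats 1000000 in
lemma comulGen_rel ⦃x y : Free⦄ (h : URel x y) :
    FreeAlgebra.lift Qv comulGen x = FreeAlgebra.lift Qv comulGen y := by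
  have hv := v_ne
  cases h <;>
    simp only [map_sub, map_mul, map_smul, map_one, FreeAlgebra.lift_ι_apply, comulGen,
      mul_add, add_mul, Algebra.TensorProduct.tmul_mul_tmul, mul_one, one_mul, mul_assoc,
      U.K1K1i, U.K1iK1, U.K2K2i, U.K2iK2, U.K1e, U.K1f, U.K2e, U.K2f, U.K1ie, U.K1if,
      U.K2ie, U.K2if, U.K2K1, U.K2iK1, U.K2K1i, U.K2iK1i, U.ef,
      assoc_aux U.K1K1i, assoc_aux U.K1iK1, assoc_aux U.K2K2i, assoc_aux U.K2iK2,
      assoc_aux U.K1e, assoc_aux U.K1f, assoc_aux U.K2e, assoc_aux U.K2f, assoc_aux U.K1ie,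
      assoc_aux U.K1if, assoc_aux U.K2ie, assoc_aux U.K2if, assoc_aux U.K2K1,
      assoc_aux U.K2iK1, assoc_aux U.K2K1i, assoc_aux U.K2iK1i, assoc_aux U.ef,
      smul_mul_assoc, mul_smul_comm, TensorProduct.smul_tmul', TensorProduct.tmul_smul,
      smul_smul, ← Algebra.TensorProduct.one_def, smul_add, mul_inv_cancel₀ hv,
      inv_mul_cancel₀ hv, one_smul, TensorProduct.tmul_add, TensorProduct.add_tmul,
      TensorProduct.tmul_sub, TensorProduct.sub_tmul, smul_sub]
  abel

/-- The comultiplication `Δ : U → U ⊗ U`. -/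
def comul : U →ₐ[Qv] U ⊗[Qv] U := U.lift comulGen comulGen_rel

/-- Values of the counit on generators. -/
def counitGen : Gen → Qv
  | .e => 0
  | .f => 0
  | _ => 1

lemma counitGen_rel ⦃x y : Free⦄ (h : URel x y) :
    FreeAlgebra.lift Qv counitGen x = FreeAlgebra.lift Qv counitGen y := by
  cases h <;> simp [counitGen]

/-- The counit `ε : U → ℚ(v)`. -/
def counit : U →ₐ[Qv] Qv := U.lift counitGen counitGen_rel

/-- The natural module `E`, with its standard basis `e₁, e₂`. -/
abbrev E : Type := Fin 2 → Qv

/-- The matrices by which the generators act on `E`. -/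
def natMat : Gen → Matrix (Fin 2) (Fin 2) Qv
  | .e => !![0, 1; 0, 0]
  | .f => !![0, 0; 1, 0]
  | .K1 => !![v, 0; 0, 1]
  | .K1inv => !![v⁻¹, 0; 0, 1]
  | .K2 => !![1, 0; 0, v]
  | .K2inv => !![1, 0; 0, v⁻¹]

lemma v_sub_inv_ne : v - v⁻¹ ≠ 0 := by
  intro h
  have h2 : v ^ 2 = 1 := by
    field_simp [v_ne] at h
    linear_combination h
  have h3 : (RatFunc.X : Qv) ^ 2 = 1 := h2
  rw [← RatFunc.algebraMap_X, ← map_pow,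
    ← map_one (algebraMap (Polynomial ℚ) (RatFunc ℚ))] at h3
  have h4 := congrArg Polynomial.natDegree (RatFunc.algebraMap_injective ℚ h3)
  simp at h4

lemma natMat_rel ⦃x y : Free⦄ (h : URel x y) :
    FreeAlgebra.lift Qv natMat x = FreeAlgebra.lift Qv natMat y := by
  have hv := v_ne
  have hv2 := v_sub_inv_ne
  have hv3 : (v - v⁻¹)⁻¹ * (v⁻¹ - v) = -1 := by
    rw [← neg_sub v, mul_neg, inv_mul_cancel₀ hv2]
  cases h <;> (ext i j; fin_cases i <;> fin_cases j <;>
    simp [natMat, Matrix.mul_apply, hv, hv2, hv3])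

/-- The natural representation `ρ : U → End(E)`. -/
def rho : U →ₐ[Qv] Module.End Qv E :=
  (Matrix.toLinAlgEquiv' (R := Qv) (n := Fin 2)).toAlgHom.comp (U.lift natMat natMat_rel)

/-- The identification `E^{⊗d} ⊗ E ≃ E^{⊗(d+1)}`. -/
def powSucc (d : ℕ) : (⨂[Qv]^d E) ⊗[Qv] E ≃ₗ[Qv] ⨂[Qv]^(d + 1) E :=
  (TensorProduct.congr (LinearEquiv.refl Qv (⨂[Qv]^d E))
    (PiTensorProduct.subsingletonEquiv (R := Qv) (s := fun _ : Fin 1 => E) (0 : Fin 1)).symm).trans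
    TensorPower.mulEquiv

/-- The representation `ρ_d : U → End(E^{⊗d})` on the `d`-th tensor power of `E`, obtained by
iterating the comultiplication; for `d = 0` it is the trivial representation, given by the
counit. -/
def rhoPow : (d : ℕ) → U →ₐ[Qv] Module.End Qv (⨂[Qv]^d E)
  | 0 => (Algebra.ofId Qv (Module.End Qv (⨂[Qv]^0 E))).comp counit
  | d + 1 => (powSucc d).conjAlgEquiv Qv |>.toAlgHom.comp
      ((Module.endTensorEndAlgHom (R := Qv) (A := Qv)).comp
        ((Algebra.TensorProduct.map (rhoPow d) rho).comp comul))

/-- The quantum Schur algebra `S_v(2,d)`, the image of `ρ_d`. -/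
def Schur (d : ℕ) : Subalgebra Qv (Module.End Qv (⨂[Qv]^d E)) := (rhoPow d).range

instance (d : ℕ) : Ring (Schur d) :=
  @Subalgebra.toRing Qv (Module.End Qv (⨂[Qv]^d E)) _ _ _ (Schur d)

/-- The image of a generator in `S_v(2,d)`. -/
def Schur.gen (d : ℕ) (x : Gen) : Schur d := (rhoPow d).rangeRestrict (U.gen x)

/-! ### Divided powers, Gaussian binomials and monomials -/

/-- The Gaussian integer `[r] = (v^r - v^{-r})/(v - v⁻¹)`. -/
def qint (r : ℤ) : Qv := (v ^ r - v ^ (-r)) / (v - v⁻¹)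

/-- `[m]! = [m][m-1]⋯[1]`. -/
def qfact (m : ℕ) : Qv := ∏ i ∈ Finset.range m, qint (i + 1)

variable {A : Type} [Ring A] [Algebra Qv A]

/-- The divided power `X^{(m)} = X^m / [m]!`. -/
def divPow (X : A) (m : ℕ) : A := (qfact m)⁻¹ • X ^ m

/-- `[X; t] = ∏_{s=1}^t (X v^{-s+1} - X⁻¹ v^{s-1}) / (v^s - v^{-s})`, where `Xinv` is the inverse
of `X`; the index `s` of the code is one less than that of the formula. -/
def qbinom (X Xinv : A) (t : ℕ) : A :=
  ((List.range t).map fun s : ℕ =>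
    (v ^ ((s : ℤ) + 1) - v ^ (-((s : ℤ) + 1)))⁻¹ •
      (v ^ (-(s : ℤ)) • X - v ^ (s : ℤ) • Xinv)).prod

/-- The element `[K₁; b₁][K₂; b₂]`, for given images `F` of the generators in `A`. -/
def KK (F : Gen → A) (b₁ b₂ : ℕ) : A :=
  qbinom (F .K1) (F .K1inv) b₁ * qbinom (F .K2) (F .K2inv) b₂

/-- The set of `(a, b₁, b₂, c)` with `b₁ + b₂ = d` and `a + b₁ + c ≤ d`. -/
def idxEF (d : ℕ) : Set (ℕ × ℕ × ℕ × ℕ) :=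
  {p | p.2.1 + p.2.2.1 = d ∧ p.1 + p.2.1 + p.2.2.2 ≤ d}

/-- The set of `(a, b₁, b₂, c)` with `b₁ + b₂ = d` and `a + b₂ + c ≤ d`. -/
def idxFE (d : ℕ) : Set (ℕ × ℕ × ℕ × ℕ) :=
  {p | p.2.1 + p.2.2.1 = d ∧ p.1 + p.2.2.1 + p.2.2.2 ≤ d}

/-- The monomial `e^{(a)} [K₁; b₁][K₂; b₂] f^{(c)}`, at `p = (a, b₁, b₂, c)`. -/
def monEF (F : Gen → A) (p : ℕ × ℕ × ℕ × ℕ) : A :=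
  divPow (F .e) p.1 * KK F p.2.1 p.2.2.1 * divPow (F .f) p.2.2.2

/-- The monomial `f^{(a)} [K₁; b₁][K₂; b₂] e^{(c)}`, at `p = (a, b₁, b₂, c)`. -/
def monFE (F : Gen → A) (p : ℕ × ℕ × ℕ × ℕ) : A :=
  divPow (F .f) p.1 * KK F p.2.1 p.2.2.1 * divPow (F .e) p.2.2.2

/-- The indexed family `x` is a `ℚ(v)`-basis of `A`. -/
def IsBasis {ι : Type} (x : ι → A) : Prop :=
  LinearIndependent Qv x ∧ Submodule.span Qv (Set.range x) = ⊤

end QSchur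

end

open scoped TensorProduct

noncomputable section

namespace QSchur

/-! ### Powers of the indeterminate -/

/-! The defining relations of `B_d` hold on `E^{⊗d}`, which gives a surjection `toSchur` from `B_d`
to the Schur algebra. The proof shows that the monomials `monEF` span `B_d` and that their images
are linearly independent. Then `toSchur` is injective, and the monomials form a basis on both sides.
Pairwise distinctness is part of linear independence of an indexed family.

Spanning: the polynomial relation diagonalizes `K₁` with eigenvalues among `v^0, …, v^d`, and `K₂ =
v^d K₁⁻¹`, so `[K₁; b₁][K₂; b₂]` is the spectral idempotent `1_{b₁}` (`KK_eq_idem`). Commuting `f`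
past `e^a` on weight vectors shows that left multiplication by `f` does not increase `a + b + c` on
the monomials `e^a 1_b f^c` (`f_mul_mem`). Monomials with `a + b + c > d` reduce to smaller ones,
since weights above `d` vanish (`mon_mem_monSpan`). The span of those with `a + b + c ≤ d` is
therefore a left ideal containing `1`.

Independence: in the tensor basis, powers of `e` and `f` have matrix coefficients that are zero or
positive at `v = 1`, so nothing cancels and a coefficient of a monomial is nonzero exactly when a
path of letter changes exists (`monomial_repr`). A suitable source and target word for each monomial
make the system triangular with respect to `b₁` (`eq_or_lt_of_reach`).

The second family follows by exchanging `e, f` and `K₁, K₂`, which preserves the relations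
(`SatB.swap`) and hence spanning. Independence is then a dimension count. -/

lemma v_pow_ne_one {n : ℕ} (hn : n ≠ 0) : v ^ n ≠ 1 := by
  intro h
  have h3 : (RatFunc.X : Qv) ^ n = 1 := h
  rw [← RatFunc.algebraMap_X, ← map_pow,
    ← map_one (algebraMap (Polynomial ℚ) (RatFunc ℚ))] at h3
  have h4 := congrArg Polynomial.natDegree (RatFunc.algebraMap_injective ℚ h3)
  simp at h4
  exact hn h4

lemma v_zpow_ne_one {n : ℤ} (hn : n ≠ 0) : v ^ n ≠ 1 := by
  intro h
  rcases Int.natAbs_eq n with h1 | h1 <;> rw [h1] at h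
  · rw [zpow_natCast] at h
    exact v_pow_ne_one (by omega) h
  · rw [zpow_neg, zpow_natCast, inv_eq_one] at h
    exact v_pow_ne_one (by omega) h

lemma v_zpow_injective : Function.Injective fun n : ℤ => v ^ n := by
  intro m n h
  by_contra hmn
  refine v_zpow_ne_one (sub_ne_zero.2 hmn) ?_
  simp only at h
  rw [zpow_sub₀ v_ne, h, div_self (zpow_ne_zero _ v_ne)]

lemma v_pow_injective : Function.Injective fun n : ℕ => v ^ n := by
  intro m n h
  exact Int.ofNat_injective (v_zpow_injective (by simpa using h))

lemma v_zpow_sub_ne {m n : ℤ} (h : m ≠ n) : v ^ m - v ^ n ≠ 0 :=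
  sub_ne_zero.2 fun h' => h (v_zpow_injective h')

lemma qint_ne {r : ℤ} (hr : r ≠ 0) : qint r ≠ 0 :=
  div_ne_zero (v_zpow_sub_ne (by omega)) v_sub_inv_ne

lemma qfact_ne (m : ℕ) : qfact m ≠ 0 :=
  Finset.prod_ne_zero_iff.2 fun i _ => qint_ne (by omega)

/-! ### Gaussian binomials on eigenvectors -/

section Eigen

variable {A : Type} [Ring A] [Algebra Qv A] {N : Type} [AddCommGroup N] [Module Qv N]
  [Module A N] [IsScalarTower Qv A N]

/-- The scalar by which `[X; t]` acts where `X` acts by `v ^ n`. -/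
def qbinomScalar (n : ℤ) (t : ℕ) : Qv :=
  ∏ s ∈ Finset.range t,
    (v ^ ((s : ℤ) + 1) - v ^ (-((s : ℤ) + 1)))⁻¹ * (v ^ (n - s) - v ^ (s - n))

variable [SMulCommClass A Qv N]

lemma qbinom_smul {X Xinv : A} {x : N} {n : ℤ} (h : X • x = v ^ n • x)
    (h' : Xinv • x = v ^ (-n) • x) (t : ℕ) :
    qbinom X Xinv t • x = qbinomScalar n t • x := by
  induction t with
  | zero => simp [qbinom, qbinomScalar]
  | succ t ih =>
    rw [qbinom, List.range_succ, List.map_append, List.prod_append, ← qbinom, mul_smul,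
      List.map_singleton, List.prod_singleton, smul_assoc, sub_smul, smul_assoc, smul_assoc, h, h',
      smul_smul, smul_smul, ← sub_smul, smul_smul, ← zpow_add₀ v_ne, ← zpow_add₀ v_ne, smul_comm,
      ih, smul_smul, qbinomScalar, qbinomScalar, Finset.prod_range_succ, neg_add_eq_sub,
      ← sub_eq_add_neg, mul_comm]

/-- Numerator and denominator have the same factors in opposite order. -/
lemma qbinomScalar_self (t : ℕ) : qbinomScalar t t = 1 := by
  have key : ∏ s ∈ Finset.range t, (v ^ ((s : ℤ) + 1) - v ^ (-((s : ℤ) + 1))) =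
      ∏ s ∈ Finset.range t, (v ^ ((t : ℤ) - s) - v ^ ((s : ℤ) - t)) := by
    rw [← Finset.prod_range_reflect]
    refine Finset.prod_congr rfl fun s hs => ?_
    have := Finset.mem_range.1 hs
    rw [show ((t - 1 - s : ℕ) : ℤ) + 1 = t - s by omega, neg_sub]
  rw [qbinomScalar, Finset.prod_mul_distrib, ← key, ← Finset.prod_mul_distrib]
  exact Finset.prod_eq_one fun s _ => inv_mul_cancel₀ (v_zpow_sub_ne (by omega))

/-- The factor at `s = n` is `v ^ 0 - v ^ 0`. -/
lemma qbinomScalar_of_lt {n t : ℕ} (h : n < t) : qbinomScalar n t = 0 :=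
  Finset.prod_eq_zero (Finset.mem_range.2 h) (by simp)

/-- If `n < b₁` the first binomial vanishes; if `n > b₁` then `d - n < b₂` and the second one does.
Working in a module `N` covers both left multiplication on an algebra and the action on tensor
space. -/
lemma KK_smul {F : Gen → A} {d n b₁ b₂ : ℕ} (hn : n ≤ d) (hb : b₁ + b₂ = d) {x : N}
    (h1 : F .K1 • x = v ^ (n : ℤ) • x) (h1i : F .K1inv • x = v ^ (-(n : ℤ)) • x)
    (h2 : F .K2 • x = v ^ ((d : ℤ) - n) • x) (h2i : F .K2inv • x = v ^ ((n : ℤ) - d) • x) :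
    KK F b₁ b₂ • x = if n = b₁ then x else 0 := by
  have e2 : ((d - n : ℕ) : ℤ) = d - n := by omega
  rw [← e2] at h2
  rw [← neg_sub, ← e2] at h2i
  rw [KK, mul_smul, qbinom_smul h2 h2i, smul_comm, qbinom_smul h1 h1i, smul_smul]
  split_ifs with h
  · obtain rfl : d - n = b₂ := by omega
    rw [h, qbinomScalar_self, qbinomScalar_self, mul_one, one_smul]
  · rcases Nat.lt_or_gt_of_ne h with h | h
    · rw [qbinomScalar_of_lt h, mul_zero, zero_smul]
    · rw [qbinomScalar_of_lt (show d - n < b₂ by omega), zero_mul, zero_smul]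

end Eigen

/-! ### Naturality of the monomials -/

section Map

variable {A A' : Type} [Ring A] [Algebra Qv A] [Ring A'] [Algebra Qv A'] (φ : A →ₐ[Qv] A')
  (F : Gen → A)

lemma map_divPow (x : A) (m : ℕ) : φ (divPow x m) = divPow (φ x) m := by
  simp [divPow]

lemma map_qbinom (x y : A) (t : ℕ) : φ (qbinom x y t) = qbinom (φ x) (φ y) t := by
  simp [qbinom, map_list_prod, Function.comp_def]

lemma map_KK (a b : ℕ) : φ (KK F a b) = KK (fun x => φ (F x)) a b := by
  simp [KK, map_qbinom]

lemma map_monEF (p : ℕ × ℕ × ℕ × ℕ) : φ (monEF F p) = monEF (fun x => φ (F x)) p := by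
  simp [monEF, map_KK, map_divPow]

lemma map_monFE (p : ℕ × ℕ × ℕ × ℕ) : φ (monFE F p) = monFE (fun x => φ (F x)) p := by
  simp [monFE, map_KK, map_divPow]

end Map

/-! ### Families satisfying the relations of `B_d` -/

/-- `F` satisfies the defining relations of `B_d`. -/
def SatB (d : ℕ) {A : Type} [Ring A] [Algebra Qv A] (F : Gen → A) : Prop :=
  ∀ ⦃x y : Free⦄, BRel d x y → FreeAlgebra.lift Qv F x = FreeAlgebra.lift Qv F y

lemma B.satB (d : ℕ) : SatB d (B.gen d) := by
  intro x y h
  have : FreeAlgebra.lift Qv (B.gen d) = RingQuot.mkAlgHom Qv (BRel d) := by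
    ext x; simp [B.gen]
  rw [this]; exact RingQuot.mkAlgHom_rel Qv h

namespace SatB

open Gen

variable {d : ℕ} {A : Type} [Ring A] [Algebra Qv A] {F : Gen → A} (h : SatB d F)
include h

lemma comm : F K1 * F K2 = F K2 * F K1 := by simpa using h (.ofU .comm)
lemma K1_mul_inv : F K1 * F K1inv = 1 := by simpa using h (.ofU .K1_mul_inv)
lemma K1_inv_mul : F K1inv * F K1 = 1 := by simpa using h (.ofU .K1_inv_mul)
lemma K2_mul_inv : F K2 * F K2inv = 1 := by simpa using h (.ofU .K2_mul_inv)
lemma K2_inv_mul : F K2inv * F K2 = 1 := by simpa using h (.ofU .K2_inv_mul)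
lemma K1_conj_e : F K1 * F e * F K1inv = v • F e := by simpa using h (.ofU .K1_e)
lemma K1_conj_f : F K1 * F f * F K1inv = v⁻¹ • F f := by simpa using h (.ofU .K1_f)
lemma K2_conj_e : F K2 * F e * F K2inv = v⁻¹ • F e := by simpa using h (.ofU .K2_e)
lemma K2_conj_f : F K2 * F f * F K2inv = v • F f := by simpa using h (.ofU .K2_f)
lemma e_f : F e * F f - F f * F e =
    (v - v⁻¹)⁻¹ • (F K1 * F K2inv - F K1inv * F K2) := by simpa using h (.ofU .e_f)
lemma det : F K1 * F K2 = algebraMap Qv A (v ^ d) := by simpa using h .det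
lemma minpoly :
    ((List.range (d + 1)).map fun i => F K1 - algebraMap Qv A (v ^ i)).prod = 0 := by
  simpa [map_list_prod, Function.comp_def] using h .minpoly

end SatB

lemma list_prod_sub_smul {A N : Type} [Ring A] [Algebra Qv A] [AddCommGroup N] [Module Qv N]
    [Module A N] [IsScalarTower Qv A N] [SMulCommClass A Qv N] {k : A} {x : N} {c : Qv}
    (hx : k • x = c • x) (l : List ℕ) :
    (l.map fun i => k - algebraMap Qv A (v ^ i)).prod • x =
      (l.map fun i : ℕ => c - v ^ i).prod • x := by
  induction l with
  | nil => simp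
  | cons a l ih =>
    rw [List.map_cons, List.prod_cons, mul_smul, ih, smul_comm, sub_smul, hx,
      algebraMap_smul, ← sub_smul, smul_smul, List.map_cons, List.prod_cons, mul_comm]

namespace SatB

open Gen

variable {d : ℕ} {A : Type} [Ring A] [Algebra Qv A] {F : Gen → A} (h : SatB d F)
include h

/-! ### Weight vectors -/

section Weight

variable {n : ℤ} {x : A} (hx : F K1 * x = v ^ n • x)
include hx

lemma K1inv_weight : F K1inv * x = v ^ (-n) • x := by
  have h1 : v ^ (-n) • (F K1inv * (F K1 * x)) = F K1inv * x := by
    rw [hx, mul_smul_comm, smul_smul, ← zpow_add₀ v_ne, neg_add_cancel, zpow_zero, one_smul]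
  rw [← h1, ← mul_assoc, h.K1_inv_mul, one_mul]

lemma K2_weight : F K2 * x = v ^ ((d : ℤ) - n) • x := by
  have h1 : F K2 * x = v ^ (-n) • (F K1 * F K2 * x) := by
    rw [h.comm, mul_assoc, hx, mul_smul_comm, smul_smul, ← zpow_add₀ v_ne, neg_add_cancel,
      zpow_zero, one_smul]
  rw [h1, h.det, ← Algebra.smul_def, smul_smul, ← zpow_natCast, ← zpow_add₀ v_ne, neg_add_eq_sub]

lemma K2inv_weight : F K2inv * x = v ^ (n - d) • x := by
  have h1 : v ^ (n - d) • (F K2inv * (F K2 * x)) = F K2inv * x := by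
    rw [h.K2_weight hx, mul_smul_comm, smul_smul, ← zpow_add₀ v_ne, sub_add_sub_cancel, sub_self,
      zpow_zero, one_smul]
  rw [← h1, ← mul_assoc, h.K2_inv_mul, one_mul]

lemma weight_e : F K1 * (F e * x) = v ^ (n + 1) • (F e * x) := by
  rw [← mul_assoc, conj_aux h.K1_inv_mul h.K1_conj_e, smul_mul_assoc, mul_assoc, hx,
    mul_smul_comm, smul_smul, zpow_add_one₀ v_ne, mul_comm]

lemma weight_f : F K1 * (F f * x) = v ^ (n - 1) • (F f * x) := by
  rw [← mul_assoc, conj_aux h.K1_inv_mul h.K1_conj_f, smul_mul_assoc, mul_assoc, hx,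
    mul_smul_comm, smul_smul, zpow_sub_one₀ v_ne, mul_comm]

lemma weight_e_pow (a : ℕ) : F K1 * (F e ^ a * x) = v ^ (n + a) • (F e ^ a * x) := by
  induction a with
  | zero => simpa using hx
  | succ a ih => rw [pow_succ', mul_assoc, h.weight_e ih, Nat.cast_succ, add_assoc]

/-- On a weight vector the torus part of the commutator is a scalar. Its value is never needed, so
only existence is recorded. -/
lemma f_mul_e : ∃ κ : Qv, F f * (F e * x) = F e * (F f * x) + κ • x := by
  refine ⟨-((v - v⁻¹)⁻¹ * (v ^ n * v ^ (n - d) - v ^ (-n) * v ^ ((d : ℤ) - n))), ?_⟩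
  have h1 := congrArg (· * x) h.e_f
  simp only [sub_mul, smul_mul_assoc, mul_assoc, h.K2inv_weight hx, h.K2_weight hx,
    mul_smul_comm, hx, h.K1inv_weight hx, smul_smul, ← sub_smul] at h1
  rw [neg_smul, sub_eq_iff_eq_add.1 h1, mul_comm (v ^ (n - d)), mul_comm (v ^ ((d : ℤ) - n))]
  abel

lemma f_mul_e_pow (a : ℕ) :
    ∃ κ : Qv, F f * (F e ^ (a + 1) * x) = F e ^ (a + 1) * (F f * x) + κ • (F e ^ a * x) := by
  induction a with
  | zero => simpa using h.f_mul_e hx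
  | succ a ih =>
    obtain ⟨κ, hκ⟩ := ih
    obtain ⟨κ', hκ'⟩ := h.f_mul_e (h.weight_e_pow hx (a + 1))
    refine ⟨κ + κ', ?_⟩
    rw [pow_succ' _ (a + 1), mul_assoc, hκ', hκ, mul_add, mul_smul_comm, ← mul_assoc (F e),
      ← mul_assoc (F e), ← pow_succ', ← pow_succ', add_smul, add_assoc]

/-- The polynomial relation acts on `x` by the product of the scalars `v ^ n - v ^ i`, which is
nonzero for such `n`. -/
lemma eq_zero_of_weight (hn : ∀ i ≤ d, n ≠ i) : x = 0 := by
  have h1 := list_prod_sub_smul (A := A) (N := A) hx (List.range (d + 1))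
  rw [h.minpoly, zero_smul, eq_comm, smul_eq_zero] at h1
  refine h1.resolve_left fun h2 => ?_
  obtain ⟨i, hi, h3⟩ := List.mem_map.1 (List.prod_eq_zero_iff.1 h2)
  rw [← zpow_natCast] at h3
  exact v_zpow_sub_ne (hn i (by simpa [Nat.lt_succ_iff] using hi)) h3

end Weight

/-! ### Weight idempotents -/

omit h in
variable (d F) in
/-- The projection to the eigenvalue `v ^ b` of `K₁`, as an interpolation polynomial in `K₁`;
zero for `b > d`. -/
def idem (b : ℕ) : A :=
  if b ≤ d then
    Polynomial.aeval (F K1) (Lagrange.basis (Finset.range (d + 1)) (fun i : ℕ => v ^ i) b)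
  else 0

omit h in
lemma idem_of_lt {b : ℕ} (hb : d < b) : idem d F b = 0 := if_neg (not_le.2 hb)

omit h in
lemma sum_idem : ∑ b ∈ Finset.range (d + 1), idem d F b = 1 := by
  rw [← map_one (Polynomial.aeval (R := Qv) (F K1)), ← Lagrange.sum_basis (s := Finset.range (d + 1))
    (v := fun i : ℕ => v ^ i) v_pow_injective.injOn ⟨0, by simp⟩, map_sum]
  exact Finset.sum_congr rfl fun b hb => if_pos (by simpa [Nat.lt_succ_iff] using hb)

/-- `X - v ^ b` times the Lagrange polynomial at `b` is a scalar multiple of the nodal polynomial,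
which kills `K₁`. -/
lemma K1_mul_idem (b : ℕ) : F K1 * idem d F b = v ^ (b : ℤ) • idem d F b := by
  rw [idem]
  split_ifs with hb
  · have hm : b ∈ Finset.range (d + 1) := by simpa [Nat.lt_succ_iff] using hb
    have h1 := congrArg (Polynomial.aeval (F K1))
      (Lagrange.nodal_eq_mul_nodal_erase (v := fun i : ℕ => v ^ i) hm)
    have h2 : Polynomial.aeval (F K1)
        (Lagrange.nodal (Finset.range (d + 1)) fun i : ℕ => v ^ i) = 0 := by
      rw [← h.minpoly, Lagrange.nodal_eq]
      -- The relation is an ordered list product because `A` is noncommutative; the product over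
      -- `Finset.range` unfolds to such a list product, so the factors can be matched.
      change Polynomial.aeval (F K1) (List.map _ (List.range (d + 1))).prod = _
      rw [map_list_prod, List.map_map]
      congr 1
      refine List.map_congr_left fun i _ => ?_
      simp
    rw [h2, map_mul, Polynomial.aeval_sub, Polynomial.aeval_X, Polynomial.aeval_C] at h1
    rw [Lagrange.basis_eq_prod_sub_inv_mul_nodal_div hm, ← Lagrange.nodal_erase_eq_nodal_div hm,
      map_mul, Polynomial.aeval_C, ← Algebra.smul_def, mul_smul_comm, smul_comm]
    congr 1
    rw [sub_mul, ← Algebra.smul_def, eq_comm, sub_eq_zero] at h1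
    rw [h1, zpow_natCast]
  · simp

omit h in
lemma aeval_mul_of_weight {n : ℤ} {x : A} (hx : F K1 * x = v ^ n • x) (p : Polynomial Qv) :
    Polynomial.aeval (F K1) p * x = p.eval (v ^ n) • x := by
  induction p using Polynomial.induction_on' with
  | add p q hp hq => rw [map_add, add_mul, hp, hq, Polynomial.eval_add, add_smul]
  | monomial k a =>
    rw [Polynomial.aeval_monomial, Polynomial.eval_monomial, mul_assoc, ← Algebra.smul_def,
      mul_smul]
    congr 1
    induction k with
    | zero => simp
    | succ k ih => rw [pow_succ, mul_assoc, hx, mul_smul_comm, ih, smul_smul, pow_succ, mul_comm]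

lemma idem_mul_of_weight {n : ℕ} {x : A} (hx : F K1 * x = v ^ (n : ℤ) • x) (b : ℕ) :
    idem d F b * x = if b = n then x else 0 := by
  by_cases hn : n ≤ d
  · have hn' : n ∈ Finset.range (d + 1) := by simpa [Nat.lt_succ_iff] using hn
    by_cases hb : b ≤ d
    · rw [idem, if_pos hb, aeval_mul_of_weight hx, zpow_natCast]
      split_ifs with hbn
      · subst hbn
        rw [Lagrange.eval_basis_self (v := fun i : ℕ => v ^ i) v_pow_injective.injOn hn', one_smul]
      · rw [Lagrange.eval_basis_of_ne (v := fun i : ℕ => v ^ i) hbn hn', zero_smul]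
    · rw [idem, if_neg hb, zero_mul, if_neg (by omega)]
  · rw [h.eq_zero_of_weight hx (by omega)]; simp

omit h in
lemma eq_sum_mul_idem (x : A) : x = ∑ k ∈ Finset.range (d + 1), x * idem d F k := by
  rw [← Finset.mul_sum, sum_idem, mul_one]

lemma f_mul_idem_zero : F f * idem d F 0 = 0 :=
  h.eq_zero_of_weight (h.weight_f (h.K1_mul_idem 0)) (by omega)

/-- Since `f` lowers weights by one, inserting `1 = ∑ 1_k` on the right of `1_b f` leaves only the
term `k = b + 1`. -/
lemma f_mul_idem_succ (b : ℕ) : F f * idem d F (b + 1) = idem d F b * F f := by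
  have hw (k : ℕ) : F K1 * (F f * idem d F (k + 1)) = v ^ (k : ℤ) • (F f * idem d F (k + 1)) := by
    simpa using h.weight_f (h.K1_mul_idem (k + 1))
  rw [eq_sum_mul_idem (idem d F b * F f), Finset.sum_range_succ', mul_assoc _ _ (idem d F 0),
    h.f_mul_idem_zero, mul_zero, add_zero]
  simp only [mul_assoc, h.idem_mul_of_weight (hw _)]
  rw [Finset.sum_ite_eq (Finset.range d)]
  split_ifs with hb
  · rfl
  -- Here `b ≥ d`: the convention that `idem` is zero above `d` makes the identity hold without a
  -- bound on `b`.
  · rw [idem_of_lt (by simp at hb; omega), mul_zero]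

lemma KK_mul_weight {n b₁ b₂ : ℕ} (hn : n ≤ d) (hb : b₁ + b₂ = d) {x : A}
    (hx : F K1 * x = v ^ (n : ℤ) • x) : KK F b₁ b₂ * x = if n = b₁ then x else 0 :=
  KK_smul (A := A) (N := A) hn hb hx (h.K1inv_weight hx) (h.K2_weight hx) (h.K2inv_weight hx)

/-- Multiplying by each `1_k` on the right, `KK_mul_weight` keeps only `k = b₁`. -/
lemma KK_eq_idem {b₁ b₂ : ℕ} (hb : b₁ + b₂ = d) : KK F b₁ b₂ = idem d F b₁ := by
  rw [eq_sum_mul_idem (KK F b₁ b₂), Finset.sum_congr rfl fun k hk =>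
    h.KK_mul_weight (by simpa [Nat.lt_succ_iff] using hk) hb (h.K1_mul_idem k),
    Finset.sum_ite_eq', if_pos (by simp; omega)]

/-! ### The span of the monomials -/

omit h in
variable (d F) in
/-- The monomial `e^a 1_b f^c`. -/
def mon (a b c : ℕ) : A := F e ^ a * (idem d F b * F f ^ c)

omit h in
variable (d F) in
/-- The span of the monomials `e^a 1_b f^c` with `a + b + c ≤ d`. -/
def monSpan : Submodule Qv A :=
  Submodule.span Qv {x | ∃ a b c : ℕ, a + b + c ≤ d ∧ mon d F a b c = x}

lemma weight_idem_mul (b : ℕ) (y : A) :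
    F K1 * (idem d F b * y) = v ^ (b : ℤ) • (idem d F b * y) := by
  rw [← mul_assoc, h.K1_mul_idem, smul_mul_assoc]

lemma weight_mon (a b c : ℕ) :
    F K1 * mon d F a b c = v ^ ((b : ℤ) + a) • mon d F a b c :=
  h.weight_e_pow (h.weight_idem_mul b _) a

lemma f_mul_mon_zero_zero (c : ℕ) : F f * mon d F 0 0 c = 0 := by
  rw [mon, pow_zero, one_mul, ← mul_assoc, h.f_mul_idem_zero, zero_mul]

lemma f_mul_mon_zero_succ (b c : ℕ) : F f * mon d F 0 (b + 1) c = mon d F 0 b (c + 1) := by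
  rw [mon, mon, pow_zero, one_mul, one_mul, ← mul_assoc, h.f_mul_idem_succ, mul_assoc, pow_succ']

lemma f_mul_mon_succ_zero (a c : ℕ) :
    ∃ κ : Qv, F f * mon d F (a + 1) 0 c = κ • mon d F a 0 c := by
  obtain ⟨κ, hκ⟩ := h.f_mul_e_pow (h.weight_idem_mul 0 (F f ^ c)) a
  refine ⟨κ, ?_⟩
  rw [mon, hκ, ← mul_assoc (F f), h.f_mul_idem_zero, zero_mul, mul_zero, zero_add, mon]

lemma f_mul_mon_succ_succ (a b c : ℕ) : ∃ κ : Qv, F f * mon d F (a + 1) (b + 1) c =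
    mon d F (a + 1) b (c + 1) + κ • mon d F a (b + 1) c := by
  obtain ⟨κ, hκ⟩ := h.f_mul_e_pow (h.weight_idem_mul (b + 1) (F f ^ c)) a
  refine ⟨κ, ?_⟩
  rw [mon, hκ, ← mul_assoc (F f), h.f_mul_idem_succ, mul_assoc (idem d F b), ← pow_succ', mon, mon]

omit h in
lemma mon_mem {a b c : ℕ} (habc : a + b + c ≤ d) : mon d F a b c ∈ monSpan d F :=
  Submodule.subset_span ⟨a, b, c, habc, rfl⟩

/-- In the four preceding formulas every monomial on the right has `a + b + c` at most that on the
left. -/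
lemma f_mul_mem {x : A} (hx : x ∈ monSpan d F) : F f * x ∈ monSpan d F := by
  induction hx using Submodule.span_induction with
  | mem x hx =>
    obtain ⟨a, b, c, habc, rfl⟩ := hx
    rcases a with _ | a <;> rcases b with _ | b
    · rw [h.f_mul_mon_zero_zero]; exact zero_mem _
    · rw [h.f_mul_mon_zero_succ]; exact mon_mem (by omega)
    · obtain ⟨κ, hκ⟩ := h.f_mul_mon_succ_zero a c
      rw [hκ]; exact Submodule.smul_mem _ _ (mon_mem (by omega))
    · obtain ⟨κ, hκ⟩ := h.f_mul_mon_succ_succ a b c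
      rw [hκ]
      exact add_mem (mon_mem (by omega)) (Submodule.smul_mem _ _ (mon_mem (by omega)))
  | zero => rw [mul_zero]; exact zero_mem _
  | add x y _ _ hx hy => rw [mul_add]; exact add_mem hx hy
  | smul r x _ hx => rw [mul_smul_comm]; exact Submodule.smul_mem _ _ hx

/-- Without `f`, a monomial with `a + b > d` has too large a weight and vanishes. For the induction
on `c`, the formula for `f * e^a 1_{b+1} f^c` is solved for its term `e^a 1_b f^{c+1}`; the other
terms contain fewer factors `f`, and the span is stable under `f`. -/
lemma mon_mem_monSpan (a b c : ℕ) : mon d F a b c ∈ monSpan d F := by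
  induction c generalizing a b with
  | zero =>
    by_cases hab : a + b ≤ d
    · exact mon_mem (by omega)
    · rw [h.eq_zero_of_weight (h.weight_mon a b 0) (by omega)]; exact zero_mem _
  | succ c ih =>
    rcases a with _ | a
    · rw [← h.f_mul_mon_zero_succ]; exact h.f_mul_mem (ih _ _)
    · obtain ⟨κ, hκ⟩ := h.f_mul_mon_succ_succ a b c
      rw [← sub_eq_iff_eq_add] at hκ
      rw [← hκ]
      exact sub_mem (h.f_mul_mem (ih _ _)) (Submodule.smul_mem _ _ (ih _ _))

omit h in
lemma mul_mem_of_mon {y x : A} (hy : ∀ a b c, y * mon d F a b c ∈ monSpan d F)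
    (hx : x ∈ monSpan d F) : y * x ∈ monSpan d F := by
  induction hx using Submodule.span_induction with
  | mem x hx => obtain ⟨a, b, c, -, rfl⟩ := hx; exact hy a b c
  | zero => rw [mul_zero]; exact zero_mem _
  | add x y _ _ hx hy => rw [mul_add]; exact add_mem hx hy
  | smul r x _ hx => rw [mul_smul_comm]; exact Submodule.smul_mem _ _ hx

/-- The torus scales each monomial. Multiplication by `e` raises `a` and may leave the range `a + b
+ c ≤ d`, which is why membership of all monomials is needed. -/
lemma gen_mul_mem (g : Gen) {x : A} (hx : x ∈ monSpan d F) : F g * x ∈ monSpan d F := by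
  cases g with
  | f => exact h.f_mul_mem hx
  | e =>
    refine mul_mem_of_mon (fun a b c => ?_) hx
    rw [mon, ← mul_assoc, ← pow_succ']
    exact h.mon_mem_monSpan (a + 1) b c
  | K1 =>
    refine mul_mem_of_mon (fun a b c => ?_) hx
    rw [h.weight_mon]; exact Submodule.smul_mem _ _ (h.mon_mem_monSpan a b c)
  | K1inv =>
    refine mul_mem_of_mon (fun a b c => ?_) hx
    rw [h.K1inv_weight (h.weight_mon a b c)]
    exact Submodule.smul_mem _ _ (h.mon_mem_monSpan a b c)
  | K2 =>
    refine mul_mem_of_mon (fun a b c => ?_) hx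
    rw [h.K2_weight (h.weight_mon a b c)]
    exact Submodule.smul_mem _ _ (h.mon_mem_monSpan a b c)
  | K2inv =>
    refine mul_mem_of_mon (fun a b c => ?_) hx
    rw [h.K2inv_weight (h.weight_mon a b c)]
    exact Submodule.smul_mem _ _ (h.mon_mem_monSpan a b c)

lemma one_mem : (1 : A) ∈ monSpan d F := by
  rw [← sum_idem (d := d) (F := F)]
  refine sum_mem fun b _ => ?_
  simpa [mon] using h.mon_mem_monSpan 0 b 0

lemma lift_mem (x : Free) : FreeAlgebra.lift Qv F x ∈ monSpan d F := by
  -- Stability under left multiplication, unlike membership, passes to products; it is applied to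
  -- `1` at the end.
  suffices H : ∀ y ∈ monSpan d F, FreeAlgebra.lift Qv F x * y ∈ monSpan d F by
    simpa using H 1 h.one_mem
  induction x using FreeAlgebra.induction with
  | grade0 r =>
    intro y hy
    rw [AlgHom.commutes, ← Algebra.smul_def]
    exact Submodule.smul_mem _ _ hy
  | grade1 g => intro y hy; rw [FreeAlgebra.lift_ι_apply]; exact h.gen_mul_mem g hy
  | mul p q hp hq => intro y hy; rw [map_mul, mul_assoc]; exact hp _ (hq _ hy)
  | add p q hp hq => intro y hy; rw [map_add, add_mul]; exact add_mem (hp _ hy) (hq _ hy)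

lemma monEF_eq {p : ℕ × ℕ × ℕ × ℕ} (hp : p ∈ idxEF d) :
    monEF F p = ((qfact p.1)⁻¹ * (qfact p.2.2.2)⁻¹) • mon d F p.1 p.2.1 p.2.2.2 := by
  rw [monEF, h.KK_eq_idem hp.1, divPow, divPow, mon, mul_smul_comm, smul_mul_assoc,
    smul_mul_assoc, smul_smul, mul_assoc, mul_comm]

/-- The monomials `monEF` span the image of the free algebra. -/
theorem span_monEF (hF : Function.Surjective (FreeAlgebra.lift Qv F)) :
    Submodule.span Qv (Set.range fun p : idxEF d => monEF F p) = ⊤ := by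
  refine top_le_iff.1 fun x _ => ?_
  obtain ⟨y, rfl⟩ := hF x
  refine (Submodule.span_le.2 ?_ : monSpan d F ≤ _) (h.lift_mem y)
  rintro _ ⟨a, b, c, habc, rfl⟩
  have hp : (a, b, d - b, c) ∈ idxEF d := ⟨by simp; omega, habc⟩
  have h1 : mon d F a b c = (qfact a * qfact c) • monEF F (a, b, d - b, c) := by
    rw [h.monEF_eq hp, smul_smul, mul_mul_mul_comm, mul_inv_cancel₀ (qfact_ne _),
      mul_inv_cancel₀ (qfact_ne _), one_mul, one_smul]
  rw [h1]
  exact Submodule.smul_mem _ _ (Submodule.subset_span ⟨⟨_, hp⟩, rfl⟩)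

end SatB

/-! ### The symmetry exchanging `e, f` and `K₁, K₂` -/

open Gen

/-- The exchange of `e, f` and of `K₁, K₂`. -/
def Gen.swap : Gen → Gen
  | e => f
  | f => e
  | K1 => K2
  | K1inv => K2inv
  | K2 => K1
  | K2inv => K1inv

lemma Gen.swap_swap (x : Gen) : x.swap.swap = x := by cases x <;> rfl

lemma commute_qbinom {A : Type} [Ring A] [Algebra Qv A] {y X Xinv : A} (h : Commute y X)
    (h' : Commute y Xinv) (t : ℕ) : Commute y (qbinom X Xinv t) := by
  refine Commute.list_prod_right _ _ fun z hz => ?_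
  obtain ⟨s, -, rfl⟩ := List.mem_map.1 hz
  exact ((h.smul_right _).sub_right (h'.smul_right _)).smul_right _

namespace SatB

variable {d : ℕ} {A : Type} [Ring A] [Algebra Qv A] {F : Gen → A} (h : SatB d F)
include h

/-- On `1_k` the element `K₂` acts by `v ^ (d - k)`, so the factor with index `d - k` vanishes. -/
lemma minpoly_K2 :
    ((List.range (d + 1)).map fun i => F K2 - algebraMap Qv A (v ^ i)).prod = 0 := by
  rw [eq_sum_mul_idem (d := d) (F := F) (List.prod _)]
  refine Finset.sum_eq_zero fun k hk => ?_
  have hk' : k ≤ d := by simpa [Nat.lt_succ_iff] using hk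
  rw [← smul_eq_mul, list_prod_sub_smul (A := A) (N := A) (h.K2_weight (h.K1_mul_idem k)), List.prod_eq_zero, zero_smul]
  refine List.mem_map.2 ⟨d - k, List.mem_range.2 (by omega), ?_⟩
  rw [← zpow_natCast, Nat.cast_sub hk', sub_self]

/-- The relations are symmetric: the commutator relation changes sign on both sides, and the
polynomial relation for `K₂` is `minpoly_K2`. -/
lemma swap : SatB d (fun x => F x.swap) := by
  intro x y hxy
  cases hxy with
  | ofU hxy =>
    cases hxy
    · simpa [Gen.swap] using h.comm.symm
    · simpa [Gen.swap] using h.K2_mul_inv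
    · simpa [Gen.swap] using h.K2_inv_mul
    · simpa [Gen.swap] using h.K1_mul_inv
    · simpa [Gen.swap] using h.K1_inv_mul
    · simpa [Gen.swap] using h.K2_conj_f
    · simpa [Gen.swap] using h.K2_conj_e
    · simpa [Gen.swap] using h.K1_conj_f
    · simpa [Gen.swap] using h.K1_conj_e
    · have h1 : F K2 * F K1inv = F K1inv * F K2 :=
        (comm_inv_aux h.comm h.K1_inv_mul h.K1_mul_inv).symm
      have h2 : F K2inv * F K1 = F K1 * F K2inv :=
        comm_inv_aux h.comm.symm h.K2_inv_mul h.K2_mul_inv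
      simp only [map_sub, map_mul, map_smul, FreeAlgebra.lift_ι_apply, Gen.swap, h1, h2]
      rw [← neg_sub (F e * F f), h.e_f, ← smul_neg, neg_sub]
  | det => simpa [Gen.swap, ← h.comm] using h.det
  | minpoly => simpa [map_list_prod, Function.comp_def, Gen.swap] using h.minpoly_K2

/-- The exchange reverses the order of the two binomials, which is harmless because they commute. -/
lemma monFE_eq (p : ℕ × ℕ × ℕ × ℕ) :
    monFE F p = monEF (fun x => F x.swap) (p.1, p.2.2.1, p.2.1, p.2.2.2) := by
  have c1 : Commute (F K1) (F K2) := h.comm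
  have c2 : Commute (F K1inv) (F K2) := comm_inv_aux h.comm h.K1_inv_mul h.K1_mul_inv
  have c3 : Commute (F K1) (F K2inv) :=
    (comm_inv_aux h.comm.symm h.K2_inv_mul h.K2_mul_inv).symm
  have c4 : Commute (F K1inv) (F K2inv) :=
    (comm_inv_aux c2.symm.eq h.K2_inv_mul h.K2_mul_inv).symm
  simp only [monFE, monEF, KK, Gen.swap]
  rw [(commute_qbinom (commute_qbinom c1 c3 _).symm
    (commute_qbinom c2 c4 _).symm p.2.1).symm.eq]

/-- The monomials `monFE` span the image of the free algebra. -/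
theorem span_monFE (hF : Function.Surjective (FreeAlgebra.lift Qv F)) :
    Submodule.span Qv (Set.range fun p : idxFE d => monFE F p) = ⊤ := by
  have hs : Function.Surjective (FreeAlgebra.lift Qv fun x : Gen => F x.swap) := by
    intro x
    obtain ⟨y, rfl⟩ := hF x
    refine ⟨FreeAlgebra.lift Qv (fun z : Gen => g z.swap) y, ?_⟩
    rw [← AlgHom.comp_apply]
    congr 1
    ext z
    simp [Gen.swap_swap]
  refine top_le_iff.1 ?_
  rw [← h.swap.span_monEF hs, Submodule.span_le]
  rintro _ ⟨⟨⟨a, b₁, b₂, c⟩, hb, hc⟩, rfl⟩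
  exact Submodule.subset_span
    ⟨⟨(a, b₂, b₁, c), by simpa [add_comm] using hb, hc⟩, h.monFE_eq _⟩

end SatB

/-- The two index sets correspond by exchanging `b₁` and `b₂`. -/
def idxEquiv (d : ℕ) : idxEF d ≃ idxFE d where
  toFun p := ⟨(p.1.1, p.1.2.2.1, p.1.2.1, p.1.2.2.2), by rw [add_comm]; exact p.2.1, p.2.2⟩
  invFun p := ⟨(p.1.1, p.1.2.2.1, p.1.2.1, p.1.2.2.2), by rw [add_comm]; exact p.2.1, p.2.2⟩
  left_inv _ := rfl
  right_inv _ := rfl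

instance (d : ℕ) : Finite (idxEF d) := by
  refine Set.Finite.to_subtype ((Set.finite_Iic (d, d, d, d)).subset ?_)
  rintro ⟨a, b₁, b₂, c⟩ ⟨h1, h2⟩
  simp only at h1 h2
  exact ⟨by simp; omega, by simp; omega, by simp; omega, by simp; omega⟩

/-! ### The tensor powers of the natural module -/

/-- The standard basis of `E`. -/
abbrev basE : Module.Basis (Fin 2) Qv E := Pi.basisFun Qv (Fin 2)

/-- The tensor basis of `E^{⊗d}`. -/
def bas (d : ℕ) : Module.Basis (Fin d → Fin 2) Qv (⨂[Qv]^d E) :=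
  Basis.piTensorProduct fun _ => basE

/-- Appending a letter to a word. -/
abbrev snoc {d : ℕ} (w : Fin d → Fin 2) (j : Fin 2) : Fin (d + 1) → Fin 2 := Fin.snoc w j

lemma powSucc_bas (d : ℕ) (w : Fin d → Fin 2) (j : Fin 2) :
    powSucc d (bas d w ⊗ₜ basE j) = bas (d + 1) (snoc w j) := by
  rw [bas, bas, Basis.piTensorProduct_apply, Basis.piTensorProduct_apply, powSucc,
    LinearEquiv.trans_apply, TensorProduct.congr_tmul, LinearEquiv.refl_apply,
    PiTensorProduct.subsingletonEquiv_symm_apply]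
  refine (TensorPower.tprod_mul_tprod Qv _ _).trans ?_
  congr 1
  rw [Fin.append_right_eq_snoc]
  ext1 i
  refine Fin.lastCases ?_ (fun i => ?_) i
  · simp
  · simp

lemma rhoPow_succ (d : ℕ) (u : U) (x : ⨂[Qv]^d E) (y : E) :
    rhoPow (d + 1) u (powSucc d (x ⊗ₜ y)) =
      powSucc d ((Module.endTensorEndAlgHom (R := Qv) (A := Qv) :
          Module.End Qv (⨂[Qv]^d E) ⊗[Qv] Module.End Qv E →ₐ[Qv]
            Module.End Qv ((⨂[Qv]^d E) ⊗[Qv] E))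
        (Algebra.TensorProduct.map (rhoPow d) rho (comul u)) (x ⊗ₜ y)) := by
  simp [rhoPow, LinearEquiv.conjAlgEquiv_apply]

lemma rhoPow_zero (u : U) (x : ⨂[Qv]^0 E) : rhoPow 0 u x = counit u • x := rfl

lemma comul_gen (x : Gen) : comul (U.gen x) = comulGen x := by
  simp [comul, U.lift, U.gen]

lemma counit_gen (x : Gen) : counit (U.gen x) = counitGen x := by
  simp [counit, U.lift, U.gen]

lemma rho_gen (x : Gen) (j : Fin 2) : rho (U.gen x) (basE j) = fun i => natMat x i j := by
  have h : rho (U.gen x) = Matrix.toLin' (natMat x) := by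
    simp only [rho, U.lift, U.gen, AlgHom.comp_apply, RingQuot.liftAlgHom_mkAlgHom_apply,
      FreeAlgebra.lift_ι_apply]
    rfl
  rw [h]
  ext i
  simp

/-- A group-like element diagonal on `E` is diagonal on `E^{⊗d}`. -/
lemma rhoPow_grouplike {u : U} (hu : comul u = u ⊗ₜ u) (hc : counit u = 1) {c : Fin 2 → Qv}
    (hr : ∀ j, rho u (basE j) = c j • basE j) (d : ℕ) (w : Fin d → Fin 2) :
    rhoPow d u (bas d w) = (∏ i, c (w i)) • bas d w := by
  induction d with
  | zero => rw [rhoPow_zero, hc, Fin.prod_univ_zero]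
  | succ d ih =>
    induction w using Fin.snocCases with
    | snoc w j =>
      rw [← powSucc_bas, rhoPow_succ, hu, Algebra.TensorProduct.map_tmul,
        Module.endTensorEndAlgHom_apply, TensorProduct.AlgebraTensorModule.map_tmul, ih, hr,
        TensorProduct.smul_tmul_smul, map_smul, Fin.prod_univ_castSucc]
      simp

/-- The number of letters `0` (that is, of tensor factors `e₁`). -/
def cnt {d : ℕ} (w : Fin d → Fin 2) : ℕ := (Finset.univ.filter fun i => w i = 0).card

lemma cnt_le {d : ℕ} (w : Fin d → Fin 2) : cnt w ≤ d :=
  (Finset.card_le_univ _).trans_eq (Fintype.card_fin d)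

lemma prod_ite_letter {d : ℕ} (w : Fin d → Fin 2) (a b : Qv) :
    ∏ i, (if w i = 0 then a else b) = a ^ cnt w * b ^ (d - cnt w) := by
  rw [Finset.prod_ite, Finset.prod_const, Finset.prod_const, cnt,
    Finset.filter_not, Finset.card_sdiff_of_subset (Finset.filter_subset _ _), Finset.card_univ,
    Fintype.card_fin]

/-! ### Weights of the tensor basis -/

section Torus

open Gen

variable (d : ℕ) (w : Fin d → Fin 2)

lemma rhoPow_torus {x : Gen} (hu : comulGen x = U.gen x ⊗ₜ U.gen x) (hc : counitGen x = 1)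
    {a b : Qv} (hr : natMat x = !![a, 0; 0, b]) :
    rhoPow d (U.gen x) (bas d w) = (a ^ cnt w * b ^ (d - cnt w)) • bas d w := by
  rw [rhoPow_grouplike ((comul_gen x).trans hu) ((counit_gen x).trans hc)
    (c := fun j => if j = 0 then a else b), prod_ite_letter]
  intro j
  rw [rho_gen, hr]
  ext i
  fin_cases i <;> fin_cases j <;> simp

lemma rhoPow_K1 : rhoPow d (U.gen K1) (bas d w) = v ^ (cnt w : ℤ) • bas d w := by
  rw [rhoPow_torus d w rfl rfl rfl, one_pow, mul_one, zpow_natCast]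

lemma rhoPow_K1inv : rhoPow d (U.gen K1inv) (bas d w) = v ^ (-(cnt w : ℤ)) • bas d w := by
  rw [rhoPow_torus d w rfl rfl rfl, one_pow, mul_one, zpow_neg, zpow_natCast, inv_pow]

lemma rhoPow_K2 : rhoPow d (U.gen K2) (bas d w) = v ^ ((d : ℤ) - cnt w) • bas d w := by
  rw [rhoPow_torus d w rfl rfl rfl, one_pow, one_mul, ← Nat.cast_sub (cnt_le w), zpow_natCast]

lemma rhoPow_K2inv : rhoPow d (U.gen K2inv) (bas d w) = v ^ ((cnt w : ℤ) - d) • bas d w := by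
  rw [rhoPow_torus d w rfl rfl rfl, one_pow, one_mul, ← neg_sub, ← Nat.cast_sub (cnt_le w),
    zpow_neg, zpow_natCast, inv_pow]

/-- The relations of `U` are automatic. The two others are checked on words, which are weight
vectors with `K₁`-exponent `cnt w` between `0` and `d`. -/
lemma satB_rhoPow : SatB d (fun x => rhoPow d (U.gen x)) := by
  have hl : FreeAlgebra.lift Qv (fun x => rhoPow d (U.gen x)) =
      (rhoPow d).comp (FreeAlgebra.lift Qv U.gen) := by
    ext x; simp
  intro x y hxy
  cases hxy with
  | ofU hxy => rw [hl, AlgHom.comp_apply, AlgHom.comp_apply, U.rel hxy]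
  | det =>
    refine (bas d).ext fun w => ?_
    rw [map_mul, FreeAlgebra.lift_ι_apply, FreeAlgebra.lift_ι_apply, AlgHom.commutes,
      Module.End.mul_apply, rhoPow_K2, map_smul, rhoPow_K1, smul_smul, ← zpow_add₀ v_ne,
      sub_add_cancel, zpow_natCast, Module.algebraMap_end_apply]
  | minpoly =>
    refine (bas d).ext fun w => ?_
    have key := list_prod_sub_smul (A := Module.End Qv (⨂[Qv]^d E)) (N := ⨂[Qv]^d E)
      (k := rhoPow d (U.gen K1)) (x := bas d w) (rhoPow_K1 d w) (List.range (d + 1))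
    have h0 : ((List.range (d + 1)).map fun i : ℕ => v ^ (cnt w : ℤ) - v ^ i).prod = 0 :=
      List.prod_eq_zero (List.mem_map.2 ⟨cnt w,
        List.mem_range.2 (Nat.lt_succ_of_le (cnt_le w)), by simp⟩)
    rw [h0, zero_smul, Module.End.smul_def] at key
    simpa [map_list_prod, Function.comp_def] using key

lemma KK_rhoPow {b₁ b₂ : ℕ} (hb : b₁ + b₂ = d) :
    KK (fun x => rhoPow d (U.gen x)) b₁ b₂ (bas d w) = if cnt w = b₁ then bas d w else 0 :=
  KK_smul (A := Module.End Qv (⨂[Qv]^d E)) (N := ⨂[Qv]^d E) (cnt_le w) hb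
    (rhoPow_K1 d w) (rhoPow_K1inv d w) (rhoPow_K2 d w) (rhoPow_K2inv d w)

end Torus

/-- The action of a skew-primitive element which changes a letter `s` into `t`. -/
lemma rhoPow_skew {u h h' : U} {s t : Fin 2} (hu : comul u = u ⊗ₜ h + h' ⊗ₜ u)
    (hc : counit u = 0) (hr : ∀ j, rho u (basE j) = if j = s then basE t else 0)
    (hh : ∀ j, ∃ z : ℤ, rho h (basE j) = v ^ z • basE j)
    (hh' : ∀ d w, ∃ z : ℤ, rhoPow d h' (bas d w) = v ^ z • bas d w)
    (d : ℕ) (w : Fin d → Fin 2) :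
    ∃ k : Fin d → ℤ, rhoPow d u (bas d w) =
      ∑ i, (if w i = s then v ^ k i else 0) • bas d (Function.update w i t) := by
  induction d with
  | zero => exact ⟨0, by rw [rhoPow_zero, hc]; simp⟩
  | succ d ih =>
    induction w using Fin.snocCases with
    | snoc w j =>
      obtain ⟨k, hk⟩ := ih w
      obtain ⟨z, hz⟩ := hh j
      obtain ⟨z', hz'⟩ := hh' d w
      -- Changing an earlier letter picks up `v ^ z` from `h` acting on the last factor; changing
      -- the last letter picks up `v ^ z'` from `h'` acting on the first `d` factors.
      refine ⟨(Fin.snoc (fun i => k i + z) z' : Fin (d + 1) → ℤ), ?_⟩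
      rw [← powSucc_bas, rhoPow_succ, hu, map_add, map_add, LinearMap.add_apply, map_add,
        Algebra.TensorProduct.map_tmul, Algebra.TensorProduct.map_tmul,
        Module.endTensorEndAlgHom_apply, Module.endTensorEndAlgHom_apply,
        TensorProduct.AlgebraTensorModule.map_tmul, TensorProduct.AlgebraTensorModule.map_tmul,
        hk, hr, hz, hz', TensorProduct.sum_tmul, map_sum, Fin.sum_univ_castSucc]
      congr 1
      · refine Finset.sum_congr rfl fun i _ => ?_
        rw [TensorProduct.smul_tmul_smul, map_smul, powSucc_bas, ← Fin.snoc_update]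
        simp only [Fin.snoc_castSucc, ite_mul, zero_mul, zpow_add₀ v_ne]
      · simp only [Fin.snoc_last, Fin.update_snoc_last]
        split_ifs
        · rw [← TensorProduct.smul_tmul', map_smul, powSucc_bas]
        · simp

section Skew

open Gen

lemma exists_rho_torus {x : Gen} {a b : ℤ} (hr : natMat x = !![v ^ a, 0; 0, v ^ b])
    (j : Fin 2) : ∃ z : ℤ, rho (U.gen x) (basE j) = v ^ z • basE j := by
  refine ⟨if j = 0 then a else b, ?_⟩
  rw [rho_gen, hr]
  ext i
  fin_cases i <;> fin_cases j <;> simp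

lemma rhoPow_e (d : ℕ) (w : Fin d → Fin 2) :
    ∃ k : Fin d → ℤ, rhoPow d (U.gen e) (bas d w) =
      ∑ i, (if w i = 1 then v ^ k i else 0) • bas d (Function.update w i 0) := by
  refine rhoPow_skew (comul_gen e) (counit_gen e) ?_ (fun j => ⟨0, by simp⟩) (fun d w => ?_) d w
  · intro j
    rw [rho_gen]
    ext i
    fin_cases i <;> fin_cases j <;> simp [natMat]
  · rw [map_mul, Module.End.mul_apply, rhoPow_K2inv, map_smul, rhoPow_K1, smul_smul,
      ← zpow_add₀ v_ne]
    exact ⟨_, rfl⟩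

lemma rhoPow_f (d : ℕ) (w : Fin d → Fin 2) :
    ∃ k : Fin d → ℤ, rhoPow d (U.gen f) (bas d w) =
      ∑ i, (if w i = 0 then v ^ k i else 0) • bas d (Function.update w i 1) := by
  refine rhoPow_skew (comul_gen f) (counit_gen f) ?_ (fun j => ?_) (fun d w => ⟨0, by simp⟩) d w
  · intro j
    rw [rho_gen]
    ext i
    fin_cases i <;> fin_cases j <;> simp [natMat]
  · obtain ⟨z, hz⟩ := exists_rho_torus (x := K2) (a := 0) (b := 1) (by simp [natMat]) j
    obtain ⟨z', hz'⟩ := exists_rho_torus (x := K1inv) (a := -1) (b := 0) (by simp [natMat]) j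
    rw [map_mul, Module.End.mul_apply, hz, map_smul, hz', smul_smul, ← zpow_add₀ v_ne]
    exact ⟨_, rfl⟩

end Skew

/-! ### A positive cone in the ground field -/

/-- `x` is, up to a power of `v`, a polynomial in `v` with positive value at `1`. -/
def Pos (x : Qv) : Prop :=
  ∃ (n : ℕ) (p : Polynomial ℚ), v ^ n * x = algebraMap (Polynomial ℚ) Qv p ∧ 0 < p.eval 1

lemma v_pow_eq (n : ℕ) : v ^ n = algebraMap (Polynomial ℚ) Qv (Polynomial.X ^ n) := by
  rw [map_pow, RatFunc.algebraMap_X, v]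

lemma Pos.ne_zero {x : Qv} (hx : Pos x) : x ≠ 0 := by
  rintro rfl
  obtain ⟨n, p, h, hp⟩ := hx
  rw [mul_zero, eq_comm, map_eq_zero_iff _ (RatFunc.algebraMap_injective ℚ)] at h
  simp [h] at hp

lemma Pos.add {x y : Qv} (hx : Pos x) (hy : Pos y) : Pos (x + y) := by
  obtain ⟨n, p, h, hp⟩ := hx
  obtain ⟨m, q, h', hq⟩ := hy
  refine ⟨n + m, Polynomial.X ^ m * p + Polynomial.X ^ n * q, ?_, ?_⟩
  · rw [map_add, map_mul, map_mul, ← h, ← h', ← v_pow_eq, ← v_pow_eq]; ring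
  · simp; positivity

lemma Pos.mul {x y : Qv} (hx : Pos x) (hy : Pos y) : Pos (x * y) := by
  obtain ⟨n, p, h, hp⟩ := hx
  obtain ⟨m, q, h', hq⟩ := hy
  refine ⟨n + m, p * q, ?_, ?_⟩
  · rw [map_mul, ← h, ← h']; ring
  · simp; positivity

lemma Pos.zpow (k : ℤ) : Pos (v ^ k) := by
  obtain ⟨n, rfl | rfl⟩ := k.eq_nat_or_neg
  · exact ⟨0, Polynomial.X ^ n, by rw [← v_pow_eq]; simp, by simp⟩
  · exact ⟨n, 1, by simp [v_ne], by simp⟩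

/-- `x` is zero or lies in the positive cone. -/
def Nonneg (x : Qv) : Prop := x = 0 ∨ Pos x

lemma Nonneg.zero : Nonneg 0 := .inl rfl

lemma Nonneg.pos {x : Qv} (hx : Nonneg x) (h : x ≠ 0) : Pos x := hx.resolve_left h

lemma Nonneg.add {x y : Qv} (hx : Nonneg x) (hy : Nonneg y) : Nonneg (x + y) := by
  rcases hx with rfl | hx
  · rwa [zero_add]
  · rcases hy with rfl | hy
    · rw [add_zero]; exact .inr hx
    · exact .inr (hx.add hy)

lemma Nonneg.mul {x y : Qv} (hx : Nonneg x) (hy : Nonneg y) : Nonneg (x * y) := by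
  rcases hx with rfl | hx
  · rw [zero_mul]; exact .zero
  · rcases hy with rfl | hy
    · rw [mul_zero]; exact .zero
    · exact .inr (hx.mul hy)

lemma Nonneg.sum {ι : Type*} {s : Finset ι} {x : ι → Qv} (h : ∀ i ∈ s, Nonneg (x i)) :
    Nonneg (∑ i ∈ s, x i) :=
  Finset.sum_induction _ Nonneg (fun _ _ => .add) .zero h

lemma Nonneg.add_ne_zero {x y : Qv} (hx : Nonneg x) (hy : Nonneg y) (h : x ≠ 0) :
    x + y ≠ 0 := by
  rcases hy with rfl | hy
  · rwa [add_zero]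
  · exact ((hx.pos h).add hy).ne_zero

/-- No cancellation: adding elements of the cone to a nonzero one cannot give zero. -/
lemma Nonneg.sum_ne_zero_iff {ι : Type*} {s : Finset ι} {x : ι → Qv}
    (h : ∀ i ∈ s, Nonneg (x i)) : ∑ i ∈ s, x i ≠ 0 ↔ ∃ i ∈ s, x i ≠ 0 := by
  classical
  refine ⟨Finset.exists_ne_zero_of_sum_ne_zero, fun ⟨i, hi, hx⟩ => ?_⟩
  rw [← Finset.add_sum_erase _ _ hi]
  exact (h i hi).add_ne_zero (.sum fun j hj => h j (Finset.mem_of_mem_erase hj)) hx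

/-! ### Supports of the powers of `e` and `f` -/

/-- `R` is obtained from `w` by changing exactly `c` letters `s` into `t`. -/
def Reach {d : ℕ} (s t : Fin 2) (c : ℕ) (w R : Fin d → Fin 2) : Prop :=
  (∀ i, w i ≠ R i → w i = s ∧ R i = t) ∧ (Finset.univ.filter fun i => w i ≠ R i).card = c

lemma reach_zero {d : ℕ} {s t : Fin 2} {w R : Fin d → Fin 2} : Reach s t 0 w R ↔ w = R := by
  constructor
  · rintro ⟨-, h⟩
    ext1 i
    by_contra hi
    simpa [hi] using Finset.eq_empty_iff_forall_notMem.1 (Finset.card_eq_zero.1 h) i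
  · rintro rfl
    simp [Reach]

/-- As `s ≠ t`, a changed letter is never changed again, so single changes occur at distinct
positions. -/
lemma reach_succ {d : ℕ} {s t : Fin 2} (hst : s ≠ t) {c : ℕ} {w R : Fin d → Fin 2} :
    Reach s t (c + 1) w R ↔ ∃ i, w i = s ∧ Reach s t c (Function.update w i t) R := by
  have filter_eq {i : Fin d} (hi : R i = t) (hw : w i = s) :
      (Finset.univ.filter fun j => w j ≠ R j) =
        insert i (Finset.univ.filter fun j => Function.update w i t j ≠ R j) := by
    ext j
    rcases eq_or_ne j i with rfl | hj
    · simp [hi, hw, hst]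
    · simp [hj]
  have notMem {i : Fin d} (hi : R i = t) :
      i ∉ Finset.univ.filter fun j => Function.update w i t j ≠ R j := by simp [hi]
  constructor
  · rintro ⟨h1, h2⟩
    obtain ⟨i, hi⟩ := Finset.card_pos.1 (h2.symm ▸ Nat.succ_pos c :
      0 < (Finset.univ.filter fun i => w i ≠ R i).card)
    obtain ⟨hw, hR⟩ := h1 i (by simpa using hi)
    refine ⟨i, hw, fun j hj => ?_, ?_⟩
    · rcases eq_or_ne j i with rfl | hji
      · simp [hR] at hj
      · rw [Function.update_of_ne hji] at hj ⊢; exact h1 j hj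
    · rw [filter_eq hR hw, Finset.card_insert_of_notMem (notMem hR)] at h2
      exact Nat.succ_injective h2
  · rintro ⟨i, hw, h1, h2⟩
    -- Otherwise position `i` of the updated word, already carrying `t`, would have to change again
    -- and hence carry `s`.
    have hR : R i = t := by
      by_contra hR
      have := (h1 i (by simpa [eq_comm] using hR)).1
      rw [Function.update_self] at this
      exact hst this.symm
    refine ⟨fun j hj => ?_, ?_⟩
    · rcases eq_or_ne j i with rfl | hji
      · exact ⟨hw, hR⟩
      · have := h1 j
        rw [Function.update_of_ne hji] at this
        exact this hj
    · rw [filter_eq hR hw, Finset.card_insert_of_notMem (notMem hR), h2]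

/-- The coefficients of `x ^ c` are nonnegative with support given by `Reach`, when `x` changes one
letter `s` into `t`. -/
lemma pow_repr {d : ℕ} {s t : Fin 2} (hst : s ≠ t) {x : Module.End Qv (⨂[Qv]^d E)}
    (hx : ∀ w, ∃ k : Fin d → ℤ, x (bas d w) =
      ∑ i, (if w i = s then v ^ k i else 0) • bas d (Function.update w i t))
    (c : ℕ) (w R : Fin d → Fin 2) :
    Nonneg ((bas d).repr ((x ^ c) (bas d w)) R) ∧
      ((bas d).repr ((x ^ c) (bas d w)) R ≠ 0 ↔ Reach s t c w R) := by
  induction c generalizing w with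
  | zero =>
    rw [pow_zero, Module.End.one_apply, Module.Basis.repr_self, reach_zero, Finsupp.single_apply]
    split_ifs with h
    · exact ⟨.inr (by simpa using Pos.zpow 0), by simp [h]⟩
    · exact ⟨.zero, by simp [h]⟩
  | succ c ih =>
    obtain ⟨k, hk⟩ := hx w
    have e1 : (bas d).repr ((x ^ (c + 1)) (bas d w)) R =
        ∑ i, (if w i = s then v ^ k i else 0) *
          (bas d).repr ((x ^ c) (bas d (Function.update w i t))) R := by
      rw [pow_succ, Module.End.mul_apply, hk, map_sum, map_sum, Finsupp.finsetSum_apply]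
      simp only [map_smul, Finsupp.smul_apply, smul_eq_mul]
    have h1 : ∀ i ∈ Finset.univ, Nonneg ((if w i = s then v ^ k i else 0) *
        (bas d).repr ((x ^ c) (bas d (Function.update w i t))) R) := by
      intro i _
      refine .mul ?_ (ih _).1
      split_ifs
      · exact .inr (.zpow _)
      · exact .zero
    rw [e1]
    refine ⟨.sum h1, ?_⟩
    rw [Nonneg.sum_ne_zero_iff h1, reach_succ hst]
    simp only [Finset.mem_univ, true_and, mul_ne_zero_iff, (ih _).2, ite_ne_right_iff, ne_eq,
      zpow_ne_zero _ v_ne, not_false_eq_true, and_true]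

open Gen in
/-- The coefficients of `e^a [K₁; b₁][K₂; b₂] f^c` are nonzero exactly where there is a path. -/
lemma monomial_repr {d : ℕ} {a b₁ b₂ c : ℕ} (hb : b₁ + b₂ = d) (S R : Fin d → Fin 2) :
    (bas d).repr ((rhoPow d (U.gen e) ^ a * KK (fun x => rhoPow d (U.gen x)) b₁ b₂ *
      rhoPow d (U.gen f) ^ c) (bas d S)) R ≠ 0 ↔
      ∃ T, cnt T = b₁ ∧ Reach 0 1 c S T ∧ Reach 1 0 a T R := by
  have hF := pow_repr (d := d) zero_ne_one (rhoPow_f d) c S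
  have hE := fun T => pow_repr (d := d) one_ne_zero (rhoPow_e d) a T R
  -- Sum over the word `T` reached after `f ^ c`; the idempotent keeps those with `b₁` letters `0`.
  have e1 : (bas d).repr ((rhoPow d (U.gen e) ^ a * KK (fun x => rhoPow d (U.gen x)) b₁ b₂ *
      rhoPow d (U.gen f) ^ c) (bas d S)) R =
      ∑ T, (bas d).repr ((rhoPow d (U.gen f) ^ c) (bas d S)) T *
        (if cnt T = b₁ then (bas d).repr ((rhoPow d (U.gen e) ^ a) (bas d T)) R else 0) := by
    rw [Module.End.mul_apply, ← (bas d).sum_repr ((rhoPow d (U.gen f) ^ c) (bas d S)), map_sum,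
      map_sum, Finsupp.finsetSum_apply]
    refine Finset.sum_congr rfl fun T _ => ?_
    rw [map_smul, map_smul, Finsupp.smul_apply, smul_eq_mul, Module.End.mul_apply,
      KK_rhoPow d T hb, (bas d).sum_repr]
    split_ifs <;> simp
  rw [e1, Nonneg.sum_ne_zero_iff]
  · simp only [Finset.mem_univ, true_and, mul_ne_zero_iff, (hF _).2, ite_ne_right_iff, (hE _).2]
    exact exists_congr fun T => by tauto
  · intro T _
    refine (hF T).1.mul ?_
    split_ifs
    · exact (hE T).1
    · exact .zero

/-! ### Linear independence -/

/-- The zeros of `w` are the disjoint union of the zeros of `R` and the changed positions. -/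
lemma cnt_add_of_reach {d c : ℕ} {w R : Fin d → Fin 2} (h : Reach 0 1 c w R) :
    cnt R + c = cnt w := by
  rw [cnt, cnt, ← h.2, ← Finset.card_union_of_disjoint]
  · congr 1
    ext i
    simp only [Finset.mem_union, Finset.mem_filter, Finset.mem_univ, true_and]
    have := h.1 i
    constructor
    · rintro (h1 | h1)
      · by_contra h2
        have := (this (by rw [h1]; exact h2)).1
        exact h2 this
      · exact (this h1).1
    · intro h1
      by_cases h2 : w i = R i
      · left; rw [← h2, h1]
      · exact .inr h2
  · rw [Finset.disjoint_filter]
    intro i _ h1 h2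
    have := (h.1 i h2).2
    rw [h1] at this
    exact zero_ne_one this

lemma reach_symm {d c : ℕ} {s t : Fin 2} {w R : Fin d → Fin 2} (h : Reach s t c w R) :
    Reach t s c R w :=
  ⟨fun i hi => (h.1 i hi.symm).symm, by simpa only [ne_comm] using h.2⟩

/-- The word with letters `0` exactly on the set `p`. -/
def word (d : ℕ) (p : ℕ → Prop) [DecidablePred p] : Fin d → Fin 2 := fun i => if p i then 0 else 1

lemma word_eq_zero {d : ℕ} {p : ℕ → Prop} [DecidablePred p] {i : Fin d} :
    word d p i = 0 ↔ p i := by simp [word]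

lemma card_filter_interval {d m n : ℕ} (h : m + n ≤ d) :
    (Finset.univ.filter fun i : Fin d => m ≤ i ∧ (i : ℕ) < m + n).card = n := by
  rw [← Finset.card_map Fin.valEmbedding]
  have : (Finset.univ.filter fun i : Fin d => m ≤ i ∧ (i : ℕ) < m + n).map Fin.valEmbedding =
      Finset.Ico m (m + n) := by
    ext j
    simp only [Finset.mem_map, Finset.mem_filter, Finset.mem_univ, true_and,
      Fin.valEmbedding_apply, Finset.mem_Ico]
    exact ⟨by rintro ⟨i, hi, rfl⟩; exact hi, fun hj => ⟨⟨j, by omega⟩, hj, rfl⟩⟩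
  rw [this, Nat.card_Ico, Nat.add_sub_cancel_left]

lemma cnt_word_lt {d b : ℕ} (h : b ≤ d) : cnt (word d (· < b)) = b := by
  rw [cnt]
  simp only [word_eq_zero]
  simpa using card_filter_interval (d := d) (m := 0) (n := b) (by omega)

lemma reach_word {d m n : ℕ} (h : m + n ≤ d) {p q : ℕ → Prop} [DecidablePred p]
    [DecidablePred q] (hpq : ∀ i, p i ↔ q i ∨ (m ≤ i ∧ i < m + n))
    (hq : ∀ i, m ≤ i → i < m + n → ¬ q i) : Reach 0 1 n (word d p) (word d q) := by
  have key (i : Fin d) : word d p i ≠ word d q i ↔ m ≤ i ∧ (i : ℕ) < m + n := by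
    by_cases hm : m ≤ i ∧ (i : ℕ) < m + n
    · simp [word, (hpq i).2 (.inr hm), hq i hm.1 hm.2, hm]
    · have hi : p i ↔ q i := by rw [hpq i, or_iff_left hm]
      simp only [word, hi, ne_eq, not_true_eq_false, hm]
  refine ⟨fun i hi => ?_, ?_⟩
  · have hi := (key i).1 hi
    simp [word, (hpq i).2 (.inr hi), hq i hi.1 hi.2]
  · simp only [key]
    exact card_filter_interval h

/-- A family which is triangular against a family of functionals is linearly independent. -/
lemma linearIndependent_of_triangular {A ι : Type} [Ring A] [Algebra Qv A] [Finite ι]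
    {x : ι → A} (φ : ι → A →ₗ[Qv] Qv) (deg : ι → ℕ) (h : ∀ i, φ i (x i) ≠ 0)
    (h' : ∀ i j, φ i (x j) ≠ 0 → j = i ∨ deg j < deg i) : LinearIndependent Qv x := by
  have : Fintype ι := Fintype.ofFinite _
  rw [Fintype.linearIndependent_iff]
  intro l hl
  -- By strong induction on the degree, coefficients of smaller degree already vanish, so applying
  -- `φ i` to the relation isolates `l i`.
  suffices H : ∀ b, ∀ i, deg i = b → l i = 0 from fun i => H _ i rfl
  intro b
  induction b using Nat.strong_induction_on with
  | _ b ih =>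
  rintro i rfl
  have h0 := congrArg (φ i) hl
  rw [map_sum, map_zero, Finset.sum_eq_single i (fun j _ hj => ?_) (by simp), map_smul,
    smul_eq_mul] at h0
  · exact (mul_eq_zero.1 h0).resolve_right (h i)
  · by_contra hne
    rw [map_smul, smul_eq_mul] at hne
    obtain ⟨hl', hc⟩ := mul_ne_zero_iff.1 hne
    exact hl' (ih _ ((h' i j hc).resolve_left hj) j rfl)

open Gen in
lemma monEF_repr {d : ℕ} {q : ℕ × ℕ × ℕ × ℕ} (hq : q ∈ idxEF d) (S R : Fin d → Fin 2) :
    (bas d).repr (monEF (fun x => rhoPow d (U.gen x)) q (bas d S)) R ≠ 0 ↔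
      ∃ T, cnt T = q.2.1 ∧ Reach 0 1 q.2.2.2 S T ∧ Reach 1 0 q.1 T R := by
  rw [← monomial_repr hq.1, monEF, divPow, divPow, mul_smul_comm, smul_mul_assoc,
    smul_mul_assoc, LinearMap.smul_apply, LinearMap.smul_apply, map_smul, map_smul,
    Finsupp.smul_apply, Finsupp.smul_apply, smul_eq_mul, smul_eq_mul, mul_ne_zero_iff,
    mul_ne_zero_iff]
  simp only [inv_ne_zero (qfact_ne _), ne_eq, not_false_eq_true, true_and]

/-- The initial word for the coefficient detecting `(a, b₁, b₂, c)`. -/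
def srcWord (d : ℕ) (p : ℕ × ℕ × ℕ × ℕ) : Fin d → Fin 2 := word d (· < p.2.1 + p.2.2.2)

/-- The final word for the coefficient detecting `(a, b₁, b₂, c)`. -/
def tgtWord (d : ℕ) (p : ℕ × ℕ × ℕ × ℕ) : Fin d → Fin 2 :=
  word d fun i => i < p.2.1 ∨ (p.2.1 + p.2.2.2 ≤ i ∧ i < p.2.1 + p.2.2.2 + p.1)

/-! ### Words detecting a given monomial -/

section Detect

variable {d : ℕ} {p : ℕ × ℕ × ℕ × ℕ} (hp : p ∈ idxEF d)
include hp

/-- The path passes through the word with zeros on `[0, b₁)`: `f ^ c` removes the zeros on `[b₁, b₁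
+ c)`, and `e ^ a` then adds zeros on the next `a` positions, which exist because `a + b₁ + c ≤ d`.
-/
lemma reach_srcWord : Reach 0 1 p.2.2.2 (srcWord d p) (word d (· < p.2.1)) := by
  have h := hp.2
  exact reach_word (m := p.2.1) (by omega) (fun i => by omega) (fun i => by omega)

lemma reach_tgtWord : Reach 1 0 p.1 (word d (· < p.2.1)) (tgtWord d p) := by
  have h := hp.2
  exact reach_symm
    (reach_word (m := p.2.1 + p.2.2.2) (by omega) (fun i => by omega) (fun i => by omega))

/-- Zeros of `T` are zeros of both the source and the target word, whose common zeros are exactly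
`[0, b₁)`. -/
lemma cnt_le_of_reach {a c : ℕ} {T : Fin d → Fin 2} (h1 : Reach 0 1 c (srcWord d p) T)
    (h2 : Reach 1 0 a T (tgtWord d p)) : cnt T ≤ p.2.1 := by
  have h := hp.2
  rw [← cnt_word_lt (show p.2.1 ≤ d by omega), cnt, cnt]
  refine Finset.card_le_card fun i hi => ?_
  simp only [Finset.mem_filter, Finset.mem_univ, true_and, word_eq_zero] at hi ⊢
  have hS : srcWord d p i = 0 := by
    by_contra hs
    exact hs (h1.1 i (by rw [hi]; exact hs)).1
  have hR : tgtWord d p i = 0 := by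
    by_contra hr
    exact hr (h2.1 i (by rw [hi]; exact fun h => hr h.symm)).2
  rw [srcWord, word_eq_zero] at hS
  rw [tgtWord, word_eq_zero] at hR
  omega

/-- When the values of `b₁` agree, counting zeros along both halves of the path determines `c` and
`a`, and `b₂ = d - b₁`. -/
lemma eq_or_lt_of_reach {q : ℕ × ℕ × ℕ × ℕ} (hq : q ∈ idxEF d) {T : Fin d → Fin 2}
    (hT : cnt T = q.2.1) (h1 : Reach 0 1 q.2.2.2 (srcWord d p) T)
    (h2 : Reach 1 0 q.1 T (tgtWord d p)) : q = p ∨ q.2.1 < p.2.1 := by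
  have h := hp.2
  have hle := cnt_le_of_reach hp h1 h2
  have e1 := cnt_add_of_reach h1
  have e2 := cnt_add_of_reach (reach_srcWord hp)
  have e3 := cnt_add_of_reach (reach_symm h2)
  have e4 := cnt_add_of_reach (reach_symm (reach_tgtWord hp))
  rw [cnt_word_lt (by omega)] at e2 e4
  have hpb := hp.1
  have hqb := hq.1
  refine (hle.lt_or_eq).symm.imp (fun heq => ?_) (fun hlt => by omega)
  ext <;> omega

end Detect

/-- The coefficient of `u` at the basis vectors indexed by `S` and `R`. -/
def matrixCoeff {d : ℕ} (S R : Fin d → Fin 2) : Schur d →ₗ[Qv] Qv :=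
  (bas d).coord R ∘ₗ LinearMap.applyₗ (bas d S) ∘ₗ (Schur d).val.toLinearMap

lemma matrixCoeff_monEF {d : ℕ} (S R : Fin d → Fin 2) (q : ℕ × ℕ × ℕ × ℕ) :
    matrixCoeff S R (monEF (Schur.gen d) q) =
      (bas d).repr (monEF (fun x => rhoPow d (U.gen x)) q (bas d S)) R := by
  have h : ((monEF (Schur.gen d) q : Schur d) : Module.End Qv (⨂[Qv]^d E)) =
    monEF (fun x => rhoPow d (U.gen x)) q :=
    map_monEF (A := Schur d) (A' := Module.End Qv (⨂[Qv]^d E)) (Schur d).val (Schur.gen d) q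
  rw [← h]
  rfl

theorem Schur.linearIndependent_monEF (d : ℕ) :
    LinearIndependent Qv (fun p : idxEF d => monEF (Schur.gen d) p) := by
  refine linearIndependent_of_triangular
    (fun p => matrixCoeff (srcWord d p) (tgtWord d p)) (fun p => p.1.2.1) (fun p => ?_)
    (fun p q hpq => ?_)
  · have := p.2.2
    rw [matrixCoeff_monEF, monEF_repr p.2]
    exact ⟨_, cnt_word_lt (by omega), reach_srcWord p.2, reach_tgtWord p.2⟩
  · rw [matrixCoeff_monEF, monEF_repr q.2] at hpq
    obtain ⟨T, hT, h1, h2⟩ := hpq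
    exact (eq_or_lt_of_reach p.2 q.2 hT h1 h2).imp_left Subtype.ext

/-! ### The isomorphism -/

lemma B.lift_surjective (d : ℕ) : Function.Surjective (FreeAlgebra.lift Qv (B.gen d)) := by
  have : FreeAlgebra.lift Qv (B.gen d) = RingQuot.mkAlgHom Qv (BRel d) := by
    ext x; simp [B.gen]
  rw [this]
  exact RingQuot.mkAlgHom_surjective Qv (BRel d)

lemma Schur.lift_eq (d : ℕ) : FreeAlgebra.lift Qv (Schur.gen d) =
    ((rhoPow d).rangeRestrict.comp (RingQuot.mkAlgHom Qv URel) : Free →ₐ[Qv] Schur d) := by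
  exact FreeAlgebra.hom_ext (funext fun x => FreeAlgebra.lift_ι_apply _ _)

lemma Schur.lift_surjective (d : ℕ) :
    Function.Surjective (FreeAlgebra.lift Qv (Schur.gen d)) := by
  rw [Schur.lift_eq]
  exact (rhoPow d).rangeRestrict_surjective.comp (RingQuot.mkAlgHom_surjective Qv URel)

lemma Schur.satB (d : ℕ) : SatB d (Schur.gen d) := by
  intro x y hxy
  have h := satB_rhoPow d hxy
  have e (z : Free) : ((FreeAlgebra.lift Qv (Schur.gen d) z : Schur d) :
      Module.End Qv (⨂[Qv]^d E)) = FreeAlgebra.lift Qv (fun x => rhoPow d (U.gen x)) z := by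
    rw [← Subalgebra.coe_val, ← AlgHom.comp_apply]
    congr 1
    ext x
    simp [Schur.gen]
  exact Subtype.ext (by rw [e, e, h])

/-- The surjection `B_d → S_v(2,d)`. -/
def toSchur (d : ℕ) : B d →ₐ[Qv] Schur d :=
  RingQuot.liftAlgHom Qv ⟨FreeAlgebra.lift Qv (Schur.gen d), Schur.satB d⟩

lemma toSchur_mk (d : ℕ) (x : Free) :
    toSchur d (RingQuot.mkAlgHom Qv (BRel d) x) = FreeAlgebra.lift Qv (Schur.gen d) x :=
  RingQuot.liftAlgHom_mkAlgHom_apply _ _ _ _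

lemma toSchur_gen (d : ℕ) (x : Gen) : toSchur d (B.gen d x) = Schur.gen d x :=
  (toSchur_mk d (g x)).trans (FreeAlgebra.lift_ι_apply _ _)

lemma toSchur_surjective (d : ℕ) : Function.Surjective (toSchur d) := by
  intro x
  obtain ⟨y, rfl⟩ := Schur.lift_surjective d x
  exact ⟨RingQuot.mkAlgHom Qv (BRel d) y, toSchur_mk d y⟩

/-- An element of the kernel is a combination of the spanning monomials; independence of their
images forces all coefficients to vanish. -/
lemma toSchur_injective (d : ℕ) : Function.Injective (toSchur d) := by
  refine (injective_iff_map_eq_zero _).2 fun x hx => ?_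
  obtain ⟨l, rfl⟩ := (Finsupp.mem_span_range_iff_exists_finsupp).1
    (((B.satB d).span_monEF (B.lift_surjective d)).ge (Submodule.mem_top (x := x)))
  have h := linearIndependent_iff.1 (Schur.linearIndependent_monEF d) l (by
    rw [Finsupp.linearCombination_apply, ← hx, Finsupp.sum, Finsupp.sum, map_sum]
    refine Finset.sum_congr rfl fun p _ => ?_
    rw [map_smul, map_monEF]
    simp only [toSchur_gen])
  rw [h, Finsupp.sum_zero_index]

/-- The isomorphism `B_d ≃ S_v(2,d)`. -/
def equivSchur (d : ℕ) : B d ≃ₐ[Qv] Schur d :=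
  AlgEquiv.ofBijective (toSchur d) ⟨toSchur_injective d, toSchur_surjective d⟩

lemma equivSchur_symm_gen (d : ℕ) (x : Gen) :
    (equivSchur d).symm (Schur.gen d x) = B.gen d x :=
  (equivSchur d).symm_apply_eq.2 (toSchur_gen d x).symm

lemma Schur.isBasis_monEF (d : ℕ) : IsBasis (fun p : idxEF d => monEF (Schur.gen d) p) :=
  ⟨Schur.linearIndependent_monEF d, (Schur.satB d).span_monEF (Schur.lift_surjective d)⟩

/-- A spanning family with as many members as the dimension is independent; the dimension is known
from the basis `monEF`, and exchanging `b₁` and `b₂` matches the index sets. -/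
lemma Schur.isBasis_monFE (d : ℕ) : IsBasis (fun p : idxFE d => monFE (Schur.gen d) p) := by
  have hs := (Schur.satB d).span_monFE (Schur.lift_surjective d)
  have : Fintype (idxEF d) := Fintype.ofFinite _
  have : Fintype (idxFE d) := Fintype.ofEquiv _ (idxEquiv d)
  refine ⟨linearIndependent_of_top_le_span_of_card_eq_finrank hs.ge ?_, hs⟩
  rw [Module.finrank_eq_card_basis (Module.Basis.mk (Schur.isBasis_monEF d).1
    (Schur.isBasis_monEF d).2.ge)]
  exact (Fintype.card_congr (idxEquiv d)).symm

lemma IsBasis.map {A A' ι : Type} [Ring A] [Algebra Qv A] [Ring A'] [Algebra Qv A']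
    {x : ι → A} (hx : IsBasis x) (φ : A ≃ₐ[Qv] A') : IsBasis (fun i => φ (x i)) := by
  refine ⟨hx.1.map' φ.toLinearMap (LinearMap.ker_eq_bot.2 φ.injective), ?_⟩
  have h := Submodule.map_span φ.toLinearMap (Set.range x)
  rw [hx.2, Submodule.map_top, LinearMap.range_eq_top.2 φ.surjective, ← Set.range_comp] at h
  exact h.symm

end QSchur

end

theorem theorem5p3 (d : ℕ) :
    (∃ φ : QSchur.B d ≃ₐ[QSchur.Qv] QSchur.Schur d,
      ∀ x : QSchur.Gen, φ (QSchur.B.gen d x) = QSchur.Schur.gen d x) ∧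
    QSchur.IsBasis (fun p : QSchur.idxEF d => QSchur.monEF (QSchur.B.gen d) p) ∧
    QSchur.IsBasis (fun p : QSchur.idxFE d => QSchur.monFE (QSchur.B.gen d) p) ∧
    QSchur.IsBasis (fun p : QSchur.idxEF d => QSchur.monEF (QSchur.Schur.gen d) p) ∧
    QSchur.IsBasis (fun p : QSchur.idxFE d => QSchur.monFE (QSchur.Schur.gen d) p) := by
  refine ⟨⟨QSchur.equivSchur d, QSchur.toSchur_gen d⟩, ?_, ?_, QSchur.Schur.isBasis_monEF d,
    QSchur.Schur.isBasis_monFE d⟩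
  · convert (QSchur.Schur.isBasis_monEF d).map (QSchur.equivSchur d).symm using 2 with p
    rw [← AlgEquiv.coe_toAlgHom, QSchur.map_monEF]
    simp only [AlgEquiv.coe_toAlgHom, QSchur.equivSchur_symm_gen]
  · convert (QSchur.Schur.isBasis_monFE d).map (QSchur.equivSchur d).symm using 2 with p
    rw [← AlgEquiv.coe_toAlgHom, QSchur.map_monFE]
    simp only [AlgEquiv.coe_toAlgHom, QSchur.equivSchur_symm_gen]
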